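/- Let $a=(p_{ij},q_{ij})_{2\le i+j\le 3}$ be 14 variables and let $P=x+\sum p_{ij}x^iy^j$, $Q=y+\sum q_{ij}x^iy^j$ be the generic cubic system $\dot x=Q$, $\dot y=-P$. Call a sequence $s_1,s_2,\dots\in\mathbb{Q}[a]$ a sequence of focal values if there is a formal power series $F\in\mathbb{Q}[a][[x,y]]$ of the form $F=x^2+y^2+(\text{terms of degree}\ge 3)$ such that $$\det\begin{pmatrix}F_x&F_y\\P&Q\end{pmatrix}=\sum_{j\ge1}s_j\,(x^{2j+2}+y^{2j+2}).$$ Such sequences exist, and for every such sequence the following hold. 1. $s_{12}\notin(s_1,\dots,s_{11})$, and moreover $s_{12}\notin\operatorname{rad}(s_1,\dots,s_{11})$, in $\mathbb{Q}[a]$. 2. There is a complex cubic system $c\in\mathbb{C}^{14}$ with $s_1(c)=\dots=s_{11}(c)=0$ and $s_{12}(c)\ne0$, for which there is no formal constant of motion, i.e. no $F\in\mathbb{C}[[x,y]]$ with $F=x^2+y^2+(\text{terms of degree}\ge 3)$ and $F_xQ-F_yP=0$. Thus the vanishing of the first 11 focal values does not force a center (in this formal, complex sense). 3. $m(3)\ge12$,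 where $m(3)$ is the least integer $m\geq 0$ such that for all $c\in\mathbb{C}^{14}$, $s_1(c)=\dots=s_m(c)=0$ implies $s_j(c)=0$ for all $j\ge1$. -/

import Mathlib

namespace FocalValues

/-- The exponents `(i, j)` of the monomials `x ^ i * y ^ j` with `2 ≤ i + j ≤ d`. -/
def exponents (d : ℕ) : Finset (ℕ × ℕ) :=
  (Finset.range (d + 1) ×ˢ Finset.range (d + 1)).filter
    (fun e => 2 ≤ e.1 + e.2 ∧ e.1 + e.2 ≤ d)

/-- Names for the coefficients of a system of degree at most `d`: `Sum.inl e` is the coefficient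
of the monomial with exponent `e` in `p`, and `Sum.inr e` the one in `q`. -/
abbrev CoeffIndex (d : ℕ) : Type := {e // e ∈ exponents d} ⊕ {e // e ∈ exponents d}

/-- Cubic systems have 14 coefficients. -/
theorem card_coeffIndex_three : Fintype.card (CoeffIndex 3) = 14 := by
  decide

section System

variable {R : Type*} [CommRing R]

/-- `P = x + p(x, y)`, where `x` is `X 0` and `y` is `X 1`. -/
noncomputable def sysP {d : ℕ} (c : CoeffIndex d → R) : MvPowerSeries (Fin 2) R :=
  MvPowerSeries.X 0 + ∑ e : {e // e ∈ exponents d},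
    MvPowerSeries.C (c (Sum.inl e)) *
      (MvPowerSeries.X 0 ^ e.1.1 * MvPowerSeries.X 1 ^ e.1.2)

/-- `Q = y + q(x, y)`. -/
noncomputable def sysQ {d : ℕ} (c : CoeffIndex d → R) : MvPowerSeries (Fin 2) R :=
  MvPowerSeries.X 1 + ∑ e : {e // e ∈ exponents d},
    MvPowerSeries.C (c (Sum.inr e)) *
      (MvPowerSeries.X 0 ^ e.1.1 * MvPowerSeries.X 1 ^ e.1.2)

/-- `F = x ^ 2 + y ^ 2 + (terms of degree at least 3)`. -/
def StartsWithCircle (F : MvPowerSeries (Fin 2) R) : Prop :=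
  ∀ n : Fin 2 →₀ ℕ, n.degree ≤ 2 →
    MvPowerSeries.coeff n F =
      MvPowerSeries.coeff n
        (MvPowerSeries.X 0 ^ 2 + MvPowerSeries.X 1 ^ 2 : MvPowerSeries (Fin 2) R)

/-- The determinant of the matrix with rows `(F_x, F_y)` and `(P, Q)`, that is, the derivative of
`F` along the system `x' = Q`, `y' = -P`. -/
noncomputable def orbitalDeriv (P Q F : MvPowerSeries (Fin 2) R) : MvPowerSeries (Fin 2) R :=
  Matrix.det !![MvPowerSeries.pderiv R 0 F, MvPowerSeries.pderiv R 1 F; P, Q]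

/-- The formal power series `∑ j ≥ 1, s j * (x ^ (2 j + 2) + y ^ (2 j + 2))`. In each coefficient
only finitely many summands contribute, those with `2 j + 2` equal to the degree of the
monomial. -/
noncomputable def focalSeries (s : ℕ → R) : MvPowerSeries (Fin 2) R :=
  fun n => ∑ j ∈ Finset.Icc 1 n.degree,
    MvPowerSeries.coeff n
      (MvPowerSeries.C (s j) *
        (MvPowerSeries.X 0 ^ (2 * j + 2) + MvPowerSeries.X 1 ^ (2 * j + 2)) :
          MvPowerSeries (Fin 2) R)

theorem coeff_focalSeries (s : ℕ → R) (n : Fin 2 →₀ ℕ) :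
    MvPowerSeries.coeff n (focalSeries s) = ∑ j ∈ Finset.Icc 1 n.degree,
      MvPowerSeries.coeff n
        (MvPowerSeries.C (s j) *
          (MvPowerSeries.X 0 ^ (2 * j + 2) + MvPowerSeries.X 1 ^ (2 * j + 2)) :
            MvPowerSeries (Fin 2) R) :=
  rfl

/-- `s 1, s 2, …` are focal values of `P dx + Q dy` (the value `s 0` plays no role). -/
def IsFocalSequence (P Q : MvPowerSeries (Fin 2) R) (s : ℕ → R) : Prop :=
  ∃ F : MvPowerSeries (Fin 2) R, StartsWithCircle F ∧ orbitalDeriv P Q F = focalSeries s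

/-- There is a formal constant of motion `F = x ^ 2 + y ^ 2 + ⋯`. -/
def HasFormalConstantOfMotion (P Q : MvPowerSeries (Fin 2) R) : Prop :=
  ∃ F : MvPowerSeries (Fin 2) R, StartsWithCircle F ∧ orbitalDeriv P Q F = 0

end System

/-- The polynomials `s 1, s 2, …` in the coefficients are focal values of the generic system of
degree at most `d`, the one whose coefficients are the variables. -/
def IsFocalPolynomials (d : ℕ) (s : ℕ → MvPolynomial (CoeffIndex d) ℚ) : Prop :=
  IsFocalSequence (sysP (d := d) MvPolynomial.X) (sysQ (d := d) MvPolynomial.X) s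

/-- The ideal `I_k = (s 1, …, s k)`. -/
noncomputable def focalIdeal {d : ℕ} (s : ℕ → MvPolynomial (CoeffIndex d) ℚ) (k : ℕ) :
    Ideal (MvPolynomial (CoeffIndex d) ℚ) :=
  Ideal.span (s '' Set.Icc 1 k)

/-- `m(d)`: the least `m` such that for complex systems of degree at most `d` the vanishing of
`s 1, …, s m` implies that of all `s j`. -/
noncomputable def centerBound {d : ℕ} (s : ℕ → MvPolynomial (CoeffIndex d) ℚ) : ℕ :=
  sInf {m : ℕ | ∀ c : CoeffIndex d → ℂ,
    (∀ j ∈ Set.Icc 1 m, MvPolynomial.aeval c (s j) = 0) →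
      ∀ j, 1 ≤ j → MvPolynomial.aeval c (s j) = 0}

end FocalValues

/-! Write D for the derivative along the system. In degree N the focal equation is a linear equation
for the degree-N form of F, governed by the rotation x ∂_y - y ∂_x up to sign. For odd N it is
uniquely solvable. For even N the kernel is spanned by (x² + y²)^(N/2), and the one obstruction is
absorbed by a focal value. Requiring that F contain no x^N with N ≥ 4 even makes F and the focal
values unique, and only integers up to N need to be inverted (`IsFocalUpTo.extend`, `focal_unique`).
The first nonzero focal value does not depend on the normalization: subtracting a multiple of F^r, r
≥ 2, changes D F only in degrees at least two above its order
(`focal_value_eq_of_previous_eq_zero`). One complex system with a focus of order 12 therefore gives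
all claims, for every focal sequence (`consequences_of_hasFocalOrder`).

Such a system comes from a finite computation modulo 29. The twelfth focal value lives in degree 26,
and 29 is the first prime above 26, so nothing is lost by reduction. The certificate is a system
modulo 29 with s_1 = ... = s_11 = 0 and s_12 = 1, together with eleven directions along which (s_1,
..., s_11) has identity Jacobian (`checkFocal_eq_true`, `focal_values_variedSystem`). Hensel's
lemma, as a contraction on a 29-adic ball (`exists_common_root`), lifts it to ℤ_29 with s_1, ...,
s_11 exactly zero and s_12 ≡ 1 mod 29. Finally ℚ_29 embeds in ℂ as an abstract field
(`nonempty_padic_ringHom_complex`). -/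

namespace FocalValues

open MvPowerSeries

/-! ### Orders of vanishing and coefficients of bivariate power series. -/

section OrderCalculus

variable {R : Type*} [CommRing R]

/-- All coefficients of total degree less than `n` vanish. -/
def VanishesBelow (n : ℕ) (F : MvPowerSeries (Fin 2) R) : Prop :=
  ∀ d : Fin 2 →₀ ℕ, d.degree < n → coeff d F = 0

theorem vanishesBelow_iff_le_order {n : ℕ} {F : MvPowerSeries (Fin 2) R} :
    VanishesBelow n F ↔ (n : ℕ∞) ≤ F.order :=
  ⟨fun h => nat_le_order h, fun h d hd => coeff_of_lt_order (lt_of_lt_of_le (by exact_mod_cast hd) h)⟩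

theorem VanishesBelow.mono {m n : ℕ} {F : MvPowerSeries (Fin 2) R} (h : VanishesBelow n F)
    (hmn : m ≤ n) : VanishesBelow m F :=
  fun d hd => h d (by omega)

theorem VanishesBelow.add {n : ℕ} {F G : MvPowerSeries (Fin 2) R} (hF : VanishesBelow n F)
    (hG : VanishesBelow n G) : VanishesBelow n (F + G) :=
  fun d hd => by rw [map_add, hF d hd, hG d hd, add_zero]

theorem VanishesBelow.sub {n : ℕ} {F G : MvPowerSeries (Fin 2) R} (hF : VanishesBelow n F)
    (hG : VanishesBelow n G) : VanishesBelow n (F - G) :=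
  fun d hd => by rw [map_sub, hF d hd, hG d hd, sub_zero]

theorem VanishesBelow.mul {m n : ℕ} {F G : MvPowerSeries (Fin 2) R} (hF : VanishesBelow m F)
    (hG : VanishesBelow n G) : VanishesBelow (m + n) (F * G) := by
  rw [vanishesBelow_iff_le_order] at *
  push_cast
  exact (add_le_add hF hG).trans le_order_mul

theorem VanishesBelow.mul_left {n : ℕ} {G : MvPowerSeries (Fin 2) R} (F : MvPowerSeries (Fin 2) R)
    (hG : VanishesBelow n G) : VanishesBelow n (F * G) := by
  have h : VanishesBelow 0 F := fun d hd => by omega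
  simpa using h.mul hG

theorem VanishesBelow.pow {m : ℕ} {F : MvPowerSeries (Fin 2) R} (hF : VanishesBelow m F) (k : ℕ) :
    VanishesBelow (k * m) (F ^ k) := by
  induction k with
  | zero => intro d hd; omega
  | succ k ih => rw [pow_succ, Nat.succ_mul]; exact ih.mul hF

theorem VanishesBelow.pderiv {n : ℕ} {F : MvPowerSeries (Fin 2) R} (hF : VanishesBelow (n + 1) F)
    (i : Fin 2) : VanishesBelow n (pderiv R i F) := fun d hd => by
  rw [coeff_pderiv, hF _ (by rw [map_add, Finsupp.degree_single]; omega), zero_mul]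

theorem VanishesBelow.map {S : Type*} [CommRing S] (φ : R →+* S) {n : ℕ}
    {F : MvPowerSeries (Fin 2) R} (hF : VanishesBelow n F) : VanishesBelow n (map φ F) :=
  fun d hd => by rw [coeff_map, hF d hd, map_zero]

/-- The exponent of `x ^ i * y ^ j`. -/
noncomputable def expo (i j : ℕ) : Fin 2 →₀ ℕ := Finsupp.single 0 i + Finsupp.single 1 j

@[simp] theorem expo_zero (i j : ℕ) : expo i j 0 = i := by simp [expo]

@[simp] theorem expo_one (i j : ℕ) : expo i j 1 = j := by simp [expo]

@[simp] theorem degree_expo (i j : ℕ) : (expo i j).degree = i + j := by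
  simp [expo, Finsupp.degree_single]

theorem expo_eta (d : Fin 2 →₀ ℕ) : expo (d 0) (d 1) = d := by
  ext k; fin_cases k <;> simp

theorem expo_inj {i j k l : ℕ} : expo i j = expo k l ↔ i = k ∧ j = l := by
  refine ⟨fun h => ⟨?_, ?_⟩, fun ⟨h, h'⟩ => by rw [h, h']⟩
  · simpa using DFunLike.congr_fun h 0
  · simpa using DFunLike.congr_fun h 1

theorem expo_le {i j k l : ℕ} : expo i j ≤ expo k l ↔ i ≤ k ∧ j ≤ l := by
  refine ⟨fun h => ⟨by simpa using h 0, by simpa using h 1⟩, fun ⟨h, h'⟩ a => ?_⟩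
  fin_cases a <;> simpa

theorem expo_sub (i j k l : ℕ) : expo k l - expo i j = expo (k - i) (l - j) := by
  ext a; fin_cases a <;> simp

theorem vanishesBelow_iff_expo {n : ℕ} {F : MvPowerSeries (Fin 2) R} :
    VanishesBelow n F ↔ ∀ i j, i + j < n → coeff (expo i j) F = 0 := by
  refine ⟨fun h i j hij => h _ (by simpa using hij), fun h d hd => ?_⟩
  rw [← expo_eta d] at hd ⊢
  exact h _ _ (by simpa using hd)

theorem X_pow_mul_X_pow (i j : ℕ) :
    (X 0 ^ i * X 1 ^ j : MvPowerSeries (Fin 2) R) = monomial (expo i j) 1 := by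
  rw [X_pow_eq, X_pow_eq, monomial_mul_monomial, one_mul, expo]

theorem coeff_pderiv_zero (F : MvPowerSeries (Fin 2) R) (i j : ℕ) :
    coeff (expo i j) (pderiv R 0 F) = (i + 1 : ℕ) * coeff (expo (i + 1) j) F := by
  have : expo i j + Finsupp.single 0 1 = expo (i + 1) j := by
    ext a; fin_cases a <;> simp
  rw [coeff_pderiv, this, expo_zero, mul_comm]; push_cast; rfl

theorem coeff_pderiv_one (F : MvPowerSeries (Fin 2) R) (i j : ℕ) :
    coeff (expo i j) (pderiv R 1 F) = (j + 1 : ℕ) * coeff (expo i (j + 1)) F := by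
  have : expo i j + Finsupp.single 1 1 = expo i (j + 1) := by
    ext a; fin_cases a <;> simp
  rw [coeff_pderiv, this, expo_one, mul_comm]; push_cast; rfl

theorem coeff_mul_X_zero_pow_mul_X_one_pow (F : MvPowerSeries (Fin 2) R) (i j k l : ℕ) :
    coeff (expo k l) (F * (X 0 ^ i * X 1 ^ j)) =
      if i ≤ k ∧ j ≤ l then coeff (expo (k - i) (l - j)) F else 0 := by
  rw [X_pow_mul_X_pow, coeff_mul_monomial, mul_one, expo_sub]
  simp only [expo_le]

end OrderCalculus

/-! ### The orbital derivative and its linear part, the rotation. -/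

section OrbitalDeriv

variable {R : Type*} [CommRing R]

theorem orbitalDeriv_eq (P Q F : MvPowerSeries (Fin 2) R) :
    orbitalDeriv P Q F = pderiv R 0 F * Q - pderiv R 1 F * P := by
  rw [orbitalDeriv, Matrix.det_fin_two_of]

theorem orbitalDeriv_add (P Q F G : MvPowerSeries (Fin 2) R) :
    orbitalDeriv P Q (F + G) = orbitalDeriv P Q F + orbitalDeriv P Q G := by
  simp only [orbitalDeriv_eq, map_add]; ring

theorem orbitalDeriv_sub (P Q F G : MvPowerSeries (Fin 2) R) :
    orbitalDeriv P Q (F - G) = orbitalDeriv P Q F - orbitalDeriv P Q G := by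
  simp only [orbitalDeriv_eq, map_sub]; ring

theorem orbitalDeriv_C_mul (P Q F : MvPowerSeries (Fin 2) R) (a : R) :
    orbitalDeriv P Q (C a * F) = C a * orbitalDeriv P Q F := by
  have h : ∀ i, pderiv R i (C a * F) = C a * pderiv R i F := fun i => by
    rw [Derivation.leibniz, pderiv_C, smul_zero, add_zero, smul_eq_mul]
  simp only [orbitalDeriv_eq, h]; ring

theorem orbitalDeriv_pow (P Q F : MvPowerSeries (Fin 2) R) (m : ℕ) :
    orbitalDeriv P Q (F ^ (m + 1)) = (m + 1 : ℕ) * F ^ m * orbitalDeriv P Q F := by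
  simp only [orbitalDeriv_eq, Derivation.leibniz_pow, nsmul_eq_mul, smul_eq_mul,
    Nat.add_sub_cancel]; ring

theorem map_orbitalDeriv {S : Type*} [CommRing S] (φ : R →+* S) (P Q F : MvPowerSeries (Fin 2) R) :
    map φ (orbitalDeriv P Q F) = orbitalDeriv (map φ P) (map φ Q) (map φ F) := by
  have h : ∀ i, map φ (pderiv R i F) = pderiv S i (map φ F) := fun i => by
    ext d; simp [coeff_pderiv]
  simp only [orbitalDeriv_eq, map_sub, map_mul, h]

theorem map_sysP {S : Type*} [CommRing S] (φ : R →+* S) {d : ℕ} (c : CoeffIndex d → R) :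
    map φ (sysP c) = sysP (φ ∘ c) := by
  simp [sysP]

theorem map_sysQ {S : Type*} [CommRing S] (φ : R →+* S) {d : ℕ} (c : CoeffIndex d → R) :
    map φ (sysQ c) = sysQ (φ ∘ c) := by
  simp [sysQ]

theorem map_focalSeries {S : Type*} [CommRing S] (φ : R →+* S) (s : ℕ → R) :
    map φ (focalSeries s) = focalSeries (φ ∘ s) := by
  ext d
  rw [coeff_map, coeff_focalSeries, coeff_focalSeries, map_sum]
  refine Finset.sum_congr rfl fun j _ => ?_
  rw [← coeff_map]
  simp

/-- Only the summand with 2k + 2 = i + j contributes; it lies inside the cutoff of `focalSeries`.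
The bound 4 reflects that `s 0` is excluded. -/
theorem coeff_expo_focalSeries (s : ℕ → R) (i j : ℕ) :
    coeff (expo i j) (focalSeries s) =
      if (i = 0 ∨ j = 0) ∧ Even (i + j) ∧ 4 ≤ i + j then s ((i + j) / 2 - 1) else 0 := by
  have key : ∀ k, 1 ≤ k → coeff (expo i j) (C (s k) *
      (X 0 ^ (2 * k + 2) + X 1 ^ (2 * k + 2)) : MvPowerSeries (Fin 2) R) =
      if (i = 0 ∨ j = 0) ∧ i + j = 2 * k + 2 then s k else 0 := by
    intro k hk
    have h0 : (X 0 ^ (2 * k + 2) : MvPowerSeries (Fin 2) R) = X 0 ^ (2 * k + 2) * X 1 ^ 0 := by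
      rw [pow_zero, mul_one]
    have h1 : (X 1 ^ (2 * k + 2) : MvPowerSeries (Fin 2) R) = X 0 ^ 0 * X 1 ^ (2 * k + 2) := by
      rw [pow_zero, one_mul]
    rw [coeff_C_mul, map_add, h0, h1, X_pow_mul_X_pow, X_pow_mul_X_pow]
    classical
    rw [coeff_monomial, coeff_monomial]
    simp only [expo_inj]
    split_ifs <;> first | omega | simp
  rw [coeff_focalSeries, degree_expo]
  split_ifs with h
  · obtain ⟨h1, ⟨r, h2⟩, h3⟩ := h
    rw [Finset.sum_eq_single ((i + j) / 2 - 1)]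
    · rw [key _ (by omega), if_pos ⟨h1, by omega⟩]
    · intro k hk hne
      rw [key k (Finset.mem_Icc.1 hk).1, if_neg (by omega)]
    · intro hn
      exact absurd (Finset.mem_Icc.2 ⟨by omega, by omega⟩) hn
  · refine Finset.sum_eq_zero fun k hk => ?_
    rw [key k (Finset.mem_Icc.1 hk).1, if_neg]
    rintro ⟨h1, h2⟩
    exact h ⟨h1, ⟨k + 1, by omega⟩, by have := (Finset.mem_Icc.1 hk).1; omega⟩

theorem focalSeries_sub (s t : ℕ → R) :
    focalSeries s - focalSeries t = focalSeries (fun j => s j - t j) := by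
  ext d
  rw [← expo_eta d, map_sub]
  simp only [coeff_expo_focalSeries]
  split_ifs <;> simp

/-- `P` and `Q` have linear parts `x` and `y`. -/
structure IsPerturbation (P Q : MvPowerSeries (Fin 2) R) : Prop where
  left : VanishesBelow 2 (P - X 0)
  right : VanishesBelow 2 (Q - X 1)

theorem isPerturbation_sys {d : ℕ} (c : CoeffIndex d → R) :
    IsPerturbation (sysP c) (sysQ c) := by
  have key : ∀ f : {e // e ∈ exponents d} → R, VanishesBelow 2
      (∑ e : {e // e ∈ exponents d}, C (f e) * (X 0 ^ e.1.1 * X 1 ^ e.1.2) :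
        MvPowerSeries (Fin 2) R) := by
    intro f
    rw [vanishesBelow_iff_expo]
    intro i j hij
    rw [map_sum]
    refine Finset.sum_eq_zero fun e _ => ?_
    have he := (Finset.mem_filter.1 e.2).2.1
    rw [coeff_mul_X_zero_pow_mul_X_one_pow, if_neg (by omega)]
  refine ⟨?_, ?_⟩
  · simpa [sysP] using key _
  · simpa [sysQ] using key _

/-- The derivative along the linear centre. -/
noncomputable abbrev rotation (F : MvPowerSeries (Fin 2) R) : MvPowerSeries (Fin 2) R :=
  orbitalDeriv (X 0) (X 1) F

theorem coeff_rotation (F : MvPowerSeries (Fin 2) R) (i j : ℕ) :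
    coeff (expo i j) (rotation F) =
      (if 1 ≤ j then (i + 1 : ℕ) * coeff (expo (i + 1) (j - 1)) F else 0) -
      (if 1 ≤ i then (j + 1 : ℕ) * coeff (expo (i - 1) (j + 1)) F else 0) := by
  have h0 : (X 0 : MvPowerSeries (Fin 2) R) = X 0 ^ 1 * X 1 ^ 0 := by simp
  have h1 : (X 1 : MvPowerSeries (Fin 2) R) = X 0 ^ 0 * X 1 ^ 1 := by simp
  rw [rotation, orbitalDeriv_eq]
  conv_lhs => rw [h0]
  conv_lhs => enter [2, 1, 2]; rw [h1]
  rw [map_sub, coeff_mul_X_zero_pow_mul_X_one_pow, coeff_mul_X_zero_pow_mul_X_one_pow, coeff_pderiv_zero, coeff_pderiv_one]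
  simp

/-- A partial derivative loses one degree and the nonlinear parts of P and Q gain at least two.
Hence the lowest form of F sees only the rotation, which lets the focal equation be solved degree by
degree. -/
theorem VanishesBelow.orbitalDeriv_sub_rotation {P Q : MvPowerSeries (Fin 2) R}
    (h : IsPerturbation P Q) {n : ℕ} {F : MvPowerSeries (Fin 2) R} (hF : VanishesBelow n F) :
    VanishesBelow (n + 1) (orbitalDeriv P Q F - rotation F) := by
  have e : orbitalDeriv P Q F - rotation F =
      MvPowerSeries.pderiv R 0 F * (Q - X 1) - MvPowerSeries.pderiv R 1 F * (P - X 0) := by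
    simp only [rotation, orbitalDeriv_eq]; ring
  rw [e]
  cases n with
  | zero =>
    exact ((h.right.mul_left _).sub (h.left.mul_left _)).mono (by norm_num)
  | succ n => exact ((hF.pderiv 0).mul h.right).sub ((hF.pderiv 1).mul h.left)

theorem VanishesBelow.rotation {n : ℕ} {F : MvPowerSeries (Fin 2) R} (hF : VanishesBelow n F) :
    VanishesBelow n (rotation F) := by
  rw [vanishesBelow_iff_expo] at *
  intro i j hij
  rw [coeff_rotation]
  have h1 : (if 1 ≤ j then ((i + 1 : ℕ) : R) * coeff (expo (i + 1) (j - 1)) F else 0) = 0 := by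
    split_ifs
    · rw [hF _ _ (by omega), mul_zero]
    · rfl
  have h2 : (if 1 ≤ i then ((j + 1 : ℕ) : R) * coeff (expo (i - 1) (j + 1)) F else 0) = 0 := by
    split_ifs
    · rw [hF _ _ (by omega), mul_zero]
    · rfl
  rw [h1, h2, sub_zero]

theorem VanishesBelow.orbitalDeriv {P Q : MvPowerSeries (Fin 2) R}
    (h : IsPerturbation P Q) {n : ℕ} {F : MvPowerSeries (Fin 2) R} (hF : VanishesBelow n F) :
    VanishesBelow n (orbitalDeriv P Q F) := by
  have := ((hF.orbitalDeriv_sub_rotation h).mono (Nat.le_succ n)).add hF.rotation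
  rwa [sub_add_cancel] at this

end OrbitalDeriv

/-! ### The linear algebra of the rotation on forms of degree N, as a two-step recursion. -/

section TwoStepRecursion

variable {R : Type*} [CommRing R]

theorem exists_two_step_recursion {N : ℕ} (hN : ∀ n : ℕ, 1 ≤ n → n ≤ N → IsUnit (n : R))
    (r : ℕ → R) (a b : R) :
    ∃ g : ℕ → R, g 0 = a ∧ g 1 = b ∧ ∀ i, i + 2 ≤ N →
      ((i + 2 : ℕ) : R) * g (i + 2) = ((N - i : ℕ) : R) * g i + r (i + 1) := by
  let step : ℕ → R × R → R × R := fun i u =>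
    -- `Ring.inverse` is 0 on non-units; the recursion is only claimed for i + 2 ≤ N, where i + 2 is
    -- a unit.
    (u.2, Ring.inverse ((i + 2 : ℕ) : R) * (((N - i : ℕ) : R) * u.1 + r (i + 1)))
  let u : ℕ → R × R := fun n => Nat.rec (a, b) step n
  refine ⟨fun n => (u n).1, rfl, rfl, fun i hi => ?_⟩
  change ((i + 2 : ℕ) : R) * (Ring.inverse ((i + 2 : ℕ) : R) * _) = _
  rw [← mul_assoc, Ring.mul_inverse_cancel _ (hN _ (by omega) hi), one_mul]

theorem prod_mul_even_of_recursion {N : ℕ} {g : ℕ → R}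
    (h : ∀ i, i + 2 ≤ N → ((i + 2 : ℕ) : R) * g (i + 2) = ((N - i : ℕ) : R) * g i) (k : ℕ)
    (hk : 2 * k ≤ N) :
    (∏ j ∈ Finset.range k, ((2 * j + 2 : ℕ) : R)) * g (2 * k) =
      (∏ j ∈ Finset.range k, ((N - 2 * j : ℕ) : R)) * g 0 := by
  induction k with
  | zero => simp
  | succ k ih =>
    have h1 := ih (by omega)
    have h2 := h (2 * k) (by omega)
    rw [Finset.prod_range_succ, Finset.prod_range_succ]
    change _ * g (2 * k + 2) = _
    linear_combination (∏ j ∈ Finset.range k, ((2 * j + 2 : ℕ) : R)) * h2 +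
      ((N - 2 * k : ℕ) : R) * h1

theorem prod_mul_odd_of_recursion {N : ℕ} {g : ℕ → R}
    (h : ∀ i, i + 2 ≤ N → ((i + 2 : ℕ) : R) * g (i + 2) = ((N - i : ℕ) : R) * g i) (k : ℕ)
    (hk : 2 * k + 1 ≤ N) :
    (∏ j ∈ Finset.range k, ((2 * j + 3 : ℕ) : R)) * g (2 * k + 1) =
      (∏ j ∈ Finset.range k, ((N - (2 * j + 1) : ℕ) : R)) * g 1 := by
  induction k with
  | zero => simp
  | succ k ih =>
    have h1 := ih (by omega)
    have h2 := h (2 * k + 1) (by omega)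
    rw [Finset.prod_range_succ, Finset.prod_range_succ]
    change _ * g (2 * k + 1 + 2) = _
    have e : 2 * k + 3 = 2 * k + 1 + 2 := rfl
    rw [e]
    linear_combination (∏ j ∈ Finset.range k, ((2 * j + 3 : ℕ) : R)) * h2 +
      ((N - (2 * k + 1) : ℕ) : R) * h1

theorem isUnit_prod_natCast {k : ℕ} {f : ℕ → ℕ} (h : ∀ j < k, IsUnit (f j : R)) :
    IsUnit (∏ j ∈ Finset.range k, (f j : R)) := by
  rw [IsUnit.prod_iff]
  exact fun j hj => h j (Finset.mem_range.1 hj)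

/-- For even degree the first and last odd coefficients of a solution agree. -/
theorem last_odd_eq_of_recursion {k : ℕ} (hN : ∀ n : ℕ, 1 ≤ n → n ≤ 2 * k + 2 → IsUnit (n : R))
    {g : ℕ → R} (h : ∀ i, i + 2 ≤ 2 * k + 2 →
      ((i + 2 : ℕ) : R) * g (i + 2) = ((2 * k + 2 - i : ℕ) : R) * g i) :
    g (2 * k + 1) = g 1 := by
  have h1 := prod_mul_odd_of_recursion h k (by omega)
  -- Both products are 3 · 5 ⋯ (2k + 1), read in opposite orders.
  have h2 : ∏ j ∈ Finset.range k, ((2 * k + 2 - (2 * j + 1) : ℕ) : R) =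
      ∏ j ∈ Finset.range k, ((2 * j + 3 : ℕ) : R) := by
    rw [← Finset.prod_range_reflect]
    refine Finset.prod_congr rfl fun j hj => ?_
    have := Finset.mem_range.1 hj
    congr 1; omega
  rw [h2] at h1
  exact (isUnit_prod_natCast fun j hj => hN _ (by omega) (by omega)).mul_left_cancel h1

theorem eq_zero_of_recursion {N : ℕ} (hN : ∀ n : ℕ, 1 ≤ n → n ≤ N → IsUnit (n : R))
    {g : ℕ → R} (h : ∀ i, i + 2 ≤ N → ((i + 2 : ℕ) : R) * g (i + 2) = ((N - i : ℕ) : R) * g i)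
    (h0 : g 0 = 0) (h1 : g 1 = 0) (i : ℕ) (hi : i ≤ N) : g i = 0 := by
  induction i using Nat.twoStepInduction with
  | zero => exact h0
  | one => exact h1
  | more i ih _ =>
    have := h i hi
    rw [ih (by omega), mul_zero] at this
    exact (hN _ (by omega) hi).mul_right_eq_zero.1 this

/-- The degree-N focal equation with right-hand side r: the two conditions containing v are those at
x^N and y^N. For odd N the even-indexed chain runs from the free g 0 to the prescribed g (N - 1).
For even N the odd-indexed chain is prescribed at both ends, and v has to absorb the discrepancy. -/
theorem exists_recursion_boundary {N : ℕ} (hN3 : 3 ≤ N)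
    (hN : ∀ n : ℕ, 1 ≤ n → n ≤ N → IsUnit (n : R)) (r : ℕ → R) :
    ∃ (g : ℕ → R) (v : R), (Even N → g 0 = 0) ∧ (¬ Even N → v = 0) ∧ g 1 + r 0 = v ∧
      r N - g (N - 1) = v ∧ ∀ i, i + 2 ≤ N →
        ((i + 2 : ℕ) : R) * g (i + 2) = ((N - i : ℕ) : R) * g i - r (i + 1) := by
  obtain ⟨g, g0, g1, hg⟩ := exists_two_step_recursion hN (fun i => - r i) 0 (-r 0)
  rcases Nat.even_or_odd' N with ⟨k, rfl | rfl⟩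
  · obtain ⟨k, rfl⟩ : ∃ m, k = m + 1 := ⟨k - 1, by omega⟩
    obtain ⟨f, f0, f1, hf⟩ := exists_two_step_recursion hN (fun _ => (0 : R)) 0 1
    have hf' : f (2 * k + 1) = 1 := by
      rw [← f1]
      exact last_odd_eq_of_recursion hN fun i hi => by rw [hf i hi, add_zero]; rfl
    obtain ⟨w, hw⟩ := (hN 2 (by omega) (by omega)).exists_left_inv
    have hw' : w * 2 = 1 := by exact_mod_cast hw
    have e : 2 * (k + 1) - 1 = 2 * k + 1 := by omega
    rw [e]
    -- Adding v · f shifts both ends of the odd chain by v, so the two boundary conditions agree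
    -- exactly when v is half the discrepancy.
    set v := w * (r (2 * (k + 1)) - g (2 * k + 1)) with hv
    refine ⟨fun i => g i + v * f i, v, fun _ => ?_, fun h => absurd (even_two_mul _) h, ?_, ?_,
      fun i hi => ?_⟩
    · simp [g0, f0]
    · simp [g1, f1]
    · simp only [hf', hv]
      linear_combination (- (r (2 * (k + 1)) - g (2 * k + 1))) * hw'
    · linear_combination hg i hi + v * hf i hi
  · obtain ⟨f, f0, f1, hf⟩ := exists_two_step_recursion hN (fun _ => (0 : R)) 1 0
    have hk := prod_mul_even_of_recursion (g := f) (N := 2 * k + 1)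
      (fun i hi => by rw [hf i hi, add_zero]) k (by omega)
    rw [f0, mul_one] at hk
    have hu : IsUnit (f (2 * k)) := by
      refine isUnit_of_mul_isUnit_right (x := ∏ j ∈ Finset.range k, ((2 * j + 2 : ℕ) : R)) ?_
      rw [hk]
      exact isUnit_prod_natCast fun j hj => hN _ (by omega) (by omega)
    obtain ⟨w, hw⟩ := hu.exists_left_inv
    set t := w * (r (2 * k + 1) - g (2 * k)) with ht
    refine ⟨fun i => g i + t * f i, 0, fun h => ?_, fun _ => rfl, ?_, ?_, fun i hi => ?_⟩
    · rw [Nat.even_iff] at h; omega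
    · simp [g1, f1]
    · simp only [Nat.add_sub_cancel, ht]
      linear_combination (- (r (2 * k + 1) - g (2 * k))) * hw
    · linear_combination hg i hi + t * hf i hi

end TwoStepRecursion

/-! ### Existence and uniqueness of normalized solutions of the focal equation. -/

section Normalized

variable {R : Type*} [CommRing R]

/-- The pure powers of `x` of degree at least `3` that are even do not occur; this fixes the
freedom in the choice of `F`. -/
def IsNormalized (F : MvPowerSeries (Fin 2) R) (N : ℕ) : Prop :=
  ∀ n, 3 ≤ n → n ≤ N → Even n → coeff (expo n 0) F = 0

theorem IsNormalized.sub {F G : MvPowerSeries (Fin 2) R} {N : ℕ} (hF : IsNormalized F N)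
    (hG : IsNormalized G N) : IsNormalized (F - G) N :=
  fun n h3 hN he => by rw [map_sub, hF n h3 hN he, hG n h3 hN he, sub_zero]

theorem IsNormalized.map {S : Type*} [CommRing S] (φ : R →+* S) {F : MvPowerSeries (Fin 2) R}
    {N : ℕ} (hF : IsNormalized F N) : IsNormalized (map φ F) N :=
  fun n h3 hN he => by rw [coeff_map, hF n h3 hN he, map_zero]

theorem vanishesBelow_succ_iff {N : ℕ} {F : MvPowerSeries (Fin 2) R} :
    VanishesBelow (N + 1) F ↔
      VanishesBelow N F ∧ ∀ i, i ≤ N → coeff (expo (N - i) i) F = 0 := by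
  refine ⟨fun h => ⟨h.mono (by omega), fun i hi => h _ (by simp; omega)⟩, fun ⟨h, h'⟩ => ?_⟩
  rw [vanishesBelow_iff_expo]
  intro i j hij
  rcases Nat.lt_or_ge (i + j) N with hlt | hge
  · exact h _ (by simpa using hlt)
  · have := h' j (by omega)
    rwa [show N - j = i by omega] at this

/-- Uniqueness of normalized formal first integrals up to focal values. -/
theorem focal_unique {P Q : MvPowerSeries (Fin 2) R} (hPQ : IsPerturbation P Q)
    {G : MvPowerSeries (Fin 2) R} {w : ℕ → R} {N : ℕ}
    (hN : ∀ n : ℕ, 1 ≤ n → n ≤ N → IsUnit (n : R)) (hG : VanishesBelow 3 G)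
    (hnorm : IsNormalized G N) (h : VanishesBelow (N + 1) (orbitalDeriv P Q G - focalSeries w)) :
    VanishesBelow (N + 1) G ∧ ∀ j, 1 ≤ j → 2 * j + 2 ≤ N → w j = 0 := by
  induction N with
  | zero => exact ⟨hG.mono (by omega), fun j _ h => by omega⟩
  | succ N ih =>
    obtain ⟨ih1, ih2⟩ := ih (fun n h1 h2 => hN n h1 (by omega))
      (fun n h1 h2 => hnorm n h1 (by omega)) (h.mono (by omega))
    rcases Nat.lt_or_ge N 2 with hlt | hge
    · exact ⟨hG.mono (by omega), fun j _ h => by omega⟩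
    -- By induction G has order at least N + 1, so the nonlinear terms do not reach this degree.
    have key : ∀ i j, i + j = N + 1 →
        coeff (expo i j) (rotation G) = coeff (expo i j) (focalSeries w) := by
      intro i j hij
      have h1 := h (expo i j) (by simp; omega)
      have h2 := ih1.orbitalDeriv_sub_rotation hPQ (expo i j) (by simp; omega)
      rw [map_sub, sub_eq_zero] at h1 h2
      rw [← h1, h2]
    simp only [coeff_rotation, coeff_expo_focalSeries] at key
    set g : ℕ → R := fun i => coeff (expo (N + 1 - i) i) G with hg
    have hrec : ∀ i, i + 2 ≤ N + 1 →
        ((i + 2 : ℕ) : R) * g (i + 2) = ((N + 1 - i : ℕ) : R) * g i := by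
      intro i hi
      have := key (N - i) (i + 1) (by omega)
      rw [if_pos (by omega), if_pos (by omega), if_neg (by omega), sub_eq_zero] at this
      simp only [hg]
      rw [show N + 1 - (i + 2) = N - i - 1 by omega, show N + 1 - i = N - i + 1 by omega]
      exact this.symm
    have hfirst := key (N + 1) 0 (by omega)
    have hlast := key 0 (N + 1) (by omega)
    rw [if_neg (by omega), if_pos (by omega)] at hfirst
    rw [if_pos (by omega), if_neg (by omega)] at hlast
    have hg1 : g 1 = coeff (expo N 1) G := rfl
    have hgN : g N = coeff (expo 1 N) G := by
      simp only [hg]; rw [show N + 1 - N = 1 by omega]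
    have hzero : (∀ i, i ≤ N + 1 → g i = 0) ∧
        ∀ j, 1 ≤ j → 2 * j + 2 ≤ N + 1 → w j = 0 := by
      by_cases he : Even (N + 1)
      · have g0 : g 0 = 0 := hnorm (N + 1) (by omega) le_rfl he
        obtain ⟨k, hk⟩ : ∃ k, N = 2 * k + 1 := by
          obtain ⟨m, hm⟩ := he; exact ⟨m - 1, by omega⟩
        have h4 : 4 ≤ N + 1 := by omega
        subst hk
        have hgg := last_odd_eq_of_recursion hN hrec
        rw [if_pos ⟨by omega, by simpa using he, by omega⟩] at hfirst hlast
        simp only [Nat.add_zero, Nat.zero_add, Nat.add_sub_cancel, Nat.cast_one, one_mul, zero_sub,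
          sub_zero] at hfirst hlast
        have hd : w ((2 * k + 1 + 1) / 2 - 1) = 0 := by
          -- The ends give -g 1 = w and g N = w, while the odd chain gives g N = g 1.
          have h2 : ((2 : ℕ) : R) * w ((2 * k + 1 + 1) / 2 - 1) = 0 := by
            push_cast
            rw [← hg1] at hfirst
            rw [← hgN] at hlast
            linear_combination - hfirst - hlast + hgg
          exact (hN 2 (by omega) (by omega)).mul_right_eq_zero.1 h2
        refine ⟨eq_zero_of_recursion hN hrec g0 ?_, fun j h1 h2 => ?_⟩
        · rw [hg1]; linear_combination - hfirst - hd
        · rcases Nat.lt_or_ge (2 * k + 1) (2 * j + 2) with h3 | h3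
          · rwa [show (2 * k + 1 + 1) / 2 - 1 = j by omega] at hd
          · exact ih2 j h1 h3
      -- In odd degree both ends vanish: g 1 = 0 kills the odd chain, and g N = 0 propagates back to
      -- g 0.
      · obtain ⟨k, hk⟩ : ∃ k, N = 2 * k := by
          rw [Nat.not_even_iff_odd] at he
          obtain ⟨m, hm⟩ := he; exact ⟨m, by omega⟩
        subst hk
        rw [if_neg (by simp only [Nat.add_zero]; tauto)] at hfirst
        rw [if_neg (by simp only [Nat.zero_add]; tauto)] at hlast
        simp only [Nat.zero_add, Nat.add_sub_cancel, Nat.cast_one, one_mul, zero_sub,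
          sub_zero, neg_eq_zero] at hfirst hlast
        have hk' := prod_mul_even_of_recursion hrec k (by omega)
        rw [hgN, hlast, mul_zero] at hk'
        have g0 : g 0 = 0 :=
          (isUnit_prod_natCast fun j hj => hN _ (by omega) (by omega)).mul_right_eq_zero.1 hk'.symm
        exact ⟨eq_zero_of_recursion hN hrec g0 hfirst, fun j h1 h2 => ih2 j h1 (by omega)⟩
    exact ⟨vanishesBelow_succ_iff.2 ⟨ih1, hzero.1⟩, hzero.2⟩

/-- `F` solves the focal equation with focal values `s` in degrees below `N`. -/
structure IsFocalUpTo (P Q : MvPowerSeries (Fin 2) R) (N : ℕ) (F : MvPowerSeries (Fin 2) R)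
    (s : ℕ → R) : Prop where
  start : StartsWithCircle F
  normalized : ∀ M, IsNormalized F M
  eqn : VanishesBelow N (orbitalDeriv P Q F - focalSeries s)

theorem startsWithCircle_iff {F : MvPowerSeries (Fin 2) R} :
    StartsWithCircle F ↔ VanishesBelow 3 (F - (X 0 ^ 2 + X 1 ^ 2)) := by
  simp only [StartsWithCircle, VanishesBelow, map_sub, sub_eq_zero, Nat.lt_succ_iff]

theorem coeff_expo_circle (i j : ℕ) :
    coeff (expo i j) (X 0 ^ 2 + X 1 ^ 2 : MvPowerSeries (Fin 2) R) =
      if (i = 2 ∧ j = 0) ∨ (i = 0 ∧ j = 2) then 1 else 0 := by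
  have h0 : (X 0 ^ 2 : MvPowerSeries (Fin 2) R) = X 0 ^ 2 * X 1 ^ 0 := by
    rw [pow_zero, mul_one]
  have h1 : (X 1 ^ 2 : MvPowerSeries (Fin 2) R) = X 0 ^ 0 * X 1 ^ 2 := by
    rw [pow_zero, one_mul]
  classical
  rw [map_add, h0, h1, X_pow_mul_X_pow, X_pow_mul_X_pow, coeff_monomial, coeff_monomial]
  simp only [expo_inj]
  split_ifs <;> first | omega | simp

theorem vanishesBelow_focalSeries (s : ℕ → R) : VanishesBelow 4 (focalSeries s) := by
  rw [vanishesBelow_iff_expo]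
  intro i j hij
  rw [coeff_expo_focalSeries, if_neg (by omega)]

theorem rotation_circle : rotation (X 0 ^ 2 + X 1 ^ 2 : MvPowerSeries (Fin 2) R) = 0 := by
  ext d
  rw [← expo_eta d, coeff_rotation, coeff_expo_circle, coeff_expo_circle, coeff_zero]
  generalize d 0 = i
  generalize d 1 = j
  by_cases h : i = 1 ∧ j = 1
  · obtain ⟨rfl, rfl⟩ := h
    simp
  · by_cases hj : 1 ≤ j <;> by_cases hi : 1 ≤ i <;> simp only [hi, hj, if_true, if_false] <;>
      repeat rw [if_neg (by omega), mul_zero]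
    all_goals simp

theorem isFocalUpTo_circle {P Q : MvPowerSeries (Fin 2) R} (hPQ : IsPerturbation P Q) :
    IsFocalUpTo P Q 3 (X 0 ^ 2 + X 1 ^ 2) 0 where
  start := fun _ _ => rfl
  normalized := fun M n h3 _ _ => by rw [coeff_expo_circle, if_neg (by omega)]
  eqn := by
    have h : VanishesBelow 2 (X 0 ^ 2 + X 1 ^ 2 : MvPowerSeries (Fin 2) R) := by
      rw [vanishesBelow_iff_expo]
      intro i j hij
      rw [coeff_expo_circle, if_neg (by omega)]
    have := h.orbitalDeriv_sub_rotation hPQ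
    rw [rotation_circle, sub_zero] at this
    exact this.sub ((vanishesBelow_focalSeries 0).mono (by omega))

/-- A correction of F by a form of degree N affects degree N of the equation only through its
rotation, so `exists_recursion_boundary` supplies the form and, for even N, the new focal value. -/
theorem IsFocalUpTo.extend {P Q : MvPowerSeries (Fin 2) R} (hPQ : IsPerturbation P Q) {N : ℕ}
    (hN3 : 3 ≤ N) (hN : ∀ n : ℕ, 1 ≤ n → n ≤ N → IsUnit (n : R))
    {F : MvPowerSeries (Fin 2) R} {s : ℕ → R} (h : IsFocalUpTo P Q N F s) :
    ∃ F' s', IsFocalUpTo P Q (N + 1) F' s' ∧ VanishesBelow N (F' - F) ∧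
      ∀ j, 2 * j + 2 < N → s' j = s j := by
  obtain ⟨g, v, hg0, hv, hfirst, hlast, hg⟩ := exists_recursion_boundary hN3 hN
    (fun j => coeff (expo (N - j) j) (orbitalDeriv P Q F))
  simp only [Nat.sub_zero, Nat.sub_self] at hfirst hlast hg
  let G : MvPowerSeries (Fin 2) R := fun d => if d 0 + d 1 = N then - g (d 1) else 0
  have hG : ∀ i j, coeff (expo i j) G = if i + j = N then - g j else 0 := by
    intro i j
    change (if expo i j 0 + expo i j 1 = N then - g (expo i j 1) else 0) = _
    simp only [expo_zero, expo_one]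
  have hGN : VanishesBelow N G := by
    rw [vanishesBelow_iff_expo]
    intro i j hij
    rw [hG, if_neg (by omega)]
  refine ⟨F + G, fun j => if 2 * j + 2 = N then v else s j, ⟨?_, ?_, ?_⟩, by simpa using hGN,
    fun j hj => if_neg (by omega)⟩
  · rw [startsWithCircle_iff, add_sub_right_comm]
    exact (startsWithCircle_iff.1 h.start).add (hGN.mono hN3)
  · intro M n h3 hn he
    rw [map_add, h.normalized M n h3 hn he, zero_add, hG]
    split_ifs with hnN
    · rw [hg0 (by rwa [← hnN]), neg_zero]
    · rfl
  · rw [vanishesBelow_iff_expo]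
    intro i j hij
    rw [orbitalDeriv_add, map_sub, map_add]
    rcases Nat.lt_or_ge (i + j) N with hlt | hge
    · have h2 := h.eqn (expo i j) (by simpa using hlt)
      rw [map_sub, sub_eq_zero, coeff_expo_focalSeries] at h2
      rw [h2, hGN.orbitalDeriv hPQ _ (by simpa using hlt), coeff_expo_focalSeries]
      split_ifs with hc
      · obtain ⟨-, ⟨m, hm⟩, -⟩ := hc
        omega
      · simp
      · simp
    · have h1 := hGN.orbitalDeriv_sub_rotation hPQ (expo i j) (by simpa using hij)
      rw [map_sub, sub_eq_zero] at h1
      rw [h1, coeff_rotation, coeff_expo_focalSeries, hG, hG]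
      obtain rfl : N = i + j := by omega
      -- The ends x^N and y^N must carry v in every degree; for odd N the focal series has no such
      -- terms, and v = 0.
      have hval : ∀ a : R, (¬ Even (i + j) → a = 0) →
          (if Even (i + j) ∧ 4 ≤ i + j then
            (if 2 * ((i + j) / 2 - 1) + 2 = i + j then a else s ((i + j) / 2 - 1)) else 0) = a := by
        intro a ha
        by_cases he : Even (i + j)
        · rw [if_pos ⟨he, by obtain ⟨m, hm⟩ := he; omega⟩,
            if_pos (by obtain ⟨m, hm⟩ := he; omega)]
        · rw [if_neg (by tauto), ha he]
      rcases Nat.eq_zero_or_pos j with rfl | hj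
      · have hv' := hval v hv
        simp only [Nat.add_zero] at hv' hfirst ⊢
        simp only [or_true, true_and, hv']
        rw [if_neg (by omega), if_pos (by omega), if_pos (by omega)]
        push_cast
        linear_combination hfirst
      · rcases Nat.eq_zero_or_pos i with rfl | hi
        · have hv' := hval v hv
          simp only [Nat.zero_add] at hv' hlast ⊢
          simp only [true_or, true_and, hv']
          rw [if_pos (by omega), if_pos (by omega), if_neg (by omega)]
          push_cast
          linear_combination hlast
        · have h3 := hg (j - 1) (by omega)
          rw [show j - 1 + 2 = j + 1 by omega, show j - 1 + 1 = j by omega,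
            show i + j - (j - 1) = i + 1 by omega, show i + j - j = i by omega] at h3
          rw [if_pos (by omega), if_pos (by omega), if_pos (by omega), if_pos (by omega),
            if_neg (by omega)]
          linear_combination h3

theorem exists_isFocalUpTo {P Q : MvPowerSeries (Fin 2) R} (hPQ : IsPerturbation P Q) (N : ℕ)
    (hN : ∀ n : ℕ, 1 ≤ n → n ≤ N → IsUnit (n : R)) :
    ∃ F s, IsFocalUpTo P Q (N + 1) F s := by
  induction N with
  | zero =>
    have := isFocalUpTo_circle hPQ
    exact ⟨_, _, this.start, this.normalized, this.eqn.mono (by omega)⟩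
  | succ N ih =>
    rcases Nat.lt_or_ge (N + 1) 3 with hlt | hge
    · have := isFocalUpTo_circle hPQ
      exact ⟨_, _, this.start, this.normalized, this.eqn.mono (by omega)⟩
    · obtain ⟨F, s, h⟩ := ih fun n h1 h2 => hN n h1 (by omega)
      obtain ⟨F', s', h', -⟩ := h.extend hPQ hge hN
      exact ⟨F', s', h'⟩

/-- Over a `ℚ`-algebra, focal values exist in all degrees. -/
theorem exists_isFocalSequence {P Q : MvPowerSeries (Fin 2) R} (hPQ : IsPerturbation P Q)
    (hN : ∀ n : ℕ, 1 ≤ n → IsUnit (n : R)) : ∃ s, IsFocalSequence P Q s := by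
  have step : ∀ (N : ℕ) (u : {u : MvPowerSeries (Fin 2) R × (ℕ → R) //
      IsFocalUpTo P Q (N + 3) u.1 u.2}), ∃ u' : {u : MvPowerSeries (Fin 2) R × (ℕ → R) //
      IsFocalUpTo P Q (N + 1 + 3) u.1 u.2}, VanishesBelow (N + 3) (u'.1.1 - u.1.1) ∧
        ∀ j, 2 * j + 2 < N + 3 → u'.1.2 j = u.1.2 j := by
    rintro N ⟨⟨F, s⟩, h⟩
    obtain ⟨F', s', h1, h2, h3⟩ := h.extend hPQ (by omega) fun n h1 _ => hN n h1
    exact ⟨⟨(F', s'), h1⟩, h2, h3⟩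
  choose next hnext1 hnext2 using step
  let u : ∀ N : ℕ, {u : MvPowerSeries (Fin 2) R × (ℕ → R) // IsFocalUpTo P Q (N + 3) u.1 u.2} :=
    fun N => Nat.rec ⟨(_, _), isFocalUpTo_circle hPQ⟩ next N
  have hF : ∀ N M, N ≤ M → VanishesBelow (N + 3) ((u M).1.1 - (u N).1.1) := by
    intro N M hNM
    induction M, hNM using Nat.le_induction with
    | base => rw [sub_self]; exact fun _ _ => coeff_zero _
    | succ M hNM ih =>
      have := ((hnext1 M (u M)).mono (show N + 3 ≤ M + 3 by omega)).add ih
      rwa [sub_add_sub_cancel] at this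
  have hs : ∀ N M, N ≤ M → ∀ j, 2 * j + 2 < N + 3 → (u M).1.2 j = (u N).1.2 j := by
    intro N M hNM
    induction M, hNM using Nat.le_induction with
    | base => exact fun _ _ => rfl
    | succ M hNM ih => exact fun j hj => (hnext2 M (u M) j (by omega)).trans (ih j hj)
  -- Stages from N on agree below degree N + 3, so the coefficients of degree n are final at stage
  -- n.
  let F : MvPowerSeries (Fin 2) R := fun d => coeff d (u d.degree).1.1
  have hFu : ∀ N, VanishesBelow (N + 1) (F - (u N).1.1) := by
    intro N d hd
    have := hF d.degree N (by omega) d (by omega)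
    rw [map_sub, sub_eq_zero] at this ⊢
    exact this.symm
  refine ⟨fun j => (u (2 * j + 2)).1.2 j, F, ?_, ?_⟩
  · intro d hd
    have := hFu 2 d (by omega)
    rw [map_sub, sub_eq_zero] at this
    rw [this, (u 2).2.start d hd]
  · ext d
    obtain ⟨i, j, rfl⟩ : ∃ i j, d = expo i j := ⟨_, _, (expo_eta d).symm⟩
    have h1 := (hFu (i + j)).orbitalDeriv hPQ (expo i j) (by simp)
    have h2 := (u (i + j)).2.eqn (expo i j) (by simp)
    rw [orbitalDeriv_sub, map_sub, sub_eq_zero] at h1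
    rw [map_sub, sub_eq_zero] at h2
    rw [h1, h2, coeff_expo_focalSeries, coeff_expo_focalSeries]
    split_ifs with h
    · exact hs (2 * ((i + j) / 2 - 1) + 2) (i + j) (by omega) _ (by omega)
    · rfl

end Normalized

/-! ### Independence of the first nonzero focal value from the choice of F. -/

section Canonical

variable {R : Type*} [CommRing R]

theorem StartsWithCircle.vanishesBelow {F : MvPowerSeries (Fin 2) R} (hF : StartsWithCircle F) :
    VanishesBelow 2 F := by
  rw [vanishesBelow_iff_expo]
  intro i j hij
  rw [hF _ (by simp; omega), coeff_expo_circle, if_neg (by omega)]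

theorem StartsWithCircle.coeff_pow {F : MvPowerSeries (Fin 2) R} (hF : StartsWithCircle F)
    (r : ℕ) : coeff (expo (2 * r) 0) (F ^ r) = 1 := by
  induction r with
  | zero => simp [expo]
  | succ r ih =>
    have e : F ^ (r + 1) = F ^ r * (X 0 ^ 2 * X 1 ^ 0) + F ^ r * (X 0 ^ 0 * X 1 ^ 2) +
        F ^ r * (F - (X 0 ^ 2 + X 1 ^ 2)) := by ring
    have h := (hF.vanishesBelow.pow r).mul (startsWithCircle_iff.1 hF)
    rw [e, map_add, map_add, coeff_mul_X_zero_pow_mul_X_one_pow,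
      coeff_mul_X_zero_pow_mul_X_one_pow, if_pos (by omega), if_neg (by omega),
      h _ (by simp; omega), Nat.sub_zero, show 2 * (r + 1) - 2 = 2 * r by omega, ih]
    simp

/-- Subtracting multiples of G^(r+2), whose x^(2r+4) coefficient is 1, removes the even pure powers
one by one. Since D(G^(r+2)) = (r+2) G^(r+1) D G, the derivative changes only from degree m + 2 on.
-/
theorem exists_isNormalized {P Q : MvPowerSeries (Fin 2) R} {m : ℕ} {F : MvPowerSeries (Fin 2) R}
    (hF : StartsWithCircle F) (h : VanishesBelow m (orbitalDeriv P Q F)) (N : ℕ) :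
    ∃ G, StartsWithCircle G ∧ IsNormalized G N ∧
      VanishesBelow (m + 2) (orbitalDeriv P Q G - orbitalDeriv P Q F) := by
  induction N with
  | zero =>
    refine ⟨F, hF, fun n h1 h2 _ => by omega, ?_⟩
    rw [sub_self]
    exact fun _ _ => coeff_zero _
  | succ N ih =>
    obtain ⟨G, hG, hn, hd⟩ := ih
    by_cases hc : Even (N + 1) ∧ 3 ≤ N + 1
    · obtain ⟨r, hr⟩ : ∃ r, N + 1 = 2 * (r + 2) := by
        obtain ⟨⟨r, hr⟩, h3⟩ := hc
        exact ⟨r - 2, by omega⟩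
      have hp := hG.vanishesBelow.pow (r + 2)
      refine ⟨G - C (coeff (expo (N + 1) 0) G) * G ^ (r + 2), ?_, ?_, ?_⟩
      · rw [startsWithCircle_iff, sub_right_comm]
        exact (startsWithCircle_iff.1 hG).sub ((hp.mono (by omega)).mul_left _)
      · intro n h3 hnN he
        rw [map_sub, coeff_C_mul]
        rcases Nat.lt_or_ge N n with hlt | hge
        · obtain rfl : n = N + 1 := by omega
          conv_lhs => enter [2, 2]; rw [hr, hG.coeff_pow]
          rw [mul_one, sub_self]
        · rw [hn n h3 hge he, hp _ (by simp; omega), mul_zero, sub_zero]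
      · have h1 : VanishesBelow m (orbitalDeriv P Q G) := by
          have := (hd.mono (by omega)).add h
          rwa [sub_add_cancel] at this
        have h2 := (((hG.vanishesBelow.pow (r + 1)).mul h1).mono
          (show m + 2 ≤ (r + 1) * 2 + m by omega)).mul_left
            (C (coeff (expo (N + 1) 0) G) * ((r + 1 + 1 : ℕ) : MvPowerSeries (Fin 2) R))
        have e : orbitalDeriv P Q (G - C (coeff (expo (N + 1) 0) G) * G ^ (r + 2)) -
            orbitalDeriv P Q F = orbitalDeriv P Q G - orbitalDeriv P Q F -
              C (coeff (expo (N + 1) 0) G) * ((r + 1 + 1 : ℕ) : MvPowerSeries (Fin 2) R) *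
                (G ^ (r + 1) * orbitalDeriv P Q G) := by
          rw [orbitalDeriv_sub, orbitalDeriv_C_mul, orbitalDeriv_pow]; ring
        rw [e]
        exact hd.sub h2
    · refine ⟨G, hG, fun n h3 hnN he => ?_, hd⟩
      rcases Nat.lt_or_ge N n with hlt | hge
      · obtain rfl : n = N + 1 := by omega
        exact absurd ⟨he, h3⟩ hc
      · exact hn n h3 hge he

theorem vanishesBelow_focalSeries_of_eq_zero {s : ℕ → R} {k : ℕ}
    (hs : ∀ j, 1 ≤ j → j < k → s j = 0) : VanishesBelow (2 * k + 2) (focalSeries s) := by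
  rw [vanishesBelow_iff_expo]
  intro i j hij
  rw [coeff_expo_focalSeries]
  split_ifs with h
  · exact hs _ (by omega) (by omega)
  · rfl

/-- The first non-vanishing focal value does not depend on the choice of `F`. -/
theorem focal_value_eq_of_previous_eq_zero {P Q : MvPowerSeries (Fin 2) R}
    (hPQ : IsPerturbation P Q) {k : ℕ} (hk : 1 ≤ k)
    (hN : ∀ n : ℕ, 1 ≤ n → n ≤ 2 * k + 2 → IsUnit (n : R))
    {F F' : MvPowerSeries (Fin 2) R} {s s' : ℕ → R} (hF : StartsWithCircle F)
    (hF' : StartsWithCircle F')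
    (h : VanishesBelow (2 * k + 3) (orbitalDeriv P Q F - focalSeries s))
    (h' : VanishesBelow (2 * k + 3) (orbitalDeriv P Q F' - focalSeries s'))
    (hs : ∀ j, 1 ≤ j → j < k → s j = 0) (hs' : ∀ j, 1 ≤ j → j < k → s' j = 0) :
    s k = s' k := by
  have hD := (h.mono (by omega)).add (vanishesBelow_focalSeries_of_eq_zero hs)
  have hD' := (h'.mono (by omega)).add (vanishesBelow_focalSeries_of_eq_zero hs')
  rw [sub_add_cancel] at hD hD'
  obtain ⟨G, hG, hn, hd⟩ := exists_isNormalized hF hD (2 * k + 2)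
  obtain ⟨G', hG', hn', hd'⟩ := exists_isNormalized hF' hD' (2 * k + 2)
  have h3 : VanishesBelow 3 (G - G') := by
    have := (startsWithCircle_iff.1 hG).sub (startsWithCircle_iff.1 hG')
    rwa [sub_sub_sub_cancel_right] at this
  have heq : VanishesBelow (2 * k + 2 + 1)
      (orbitalDeriv P Q (G - G') - focalSeries fun j => s j - s' j) := by
    have := ((hd.mono (by omega)).add h).sub ((hd'.mono (by omega)).add h')
    rw [← focalSeries_sub, orbitalDeriv_sub]
    convert this using 1
    ring
  exact sub_eq_zero.1 ((focal_unique hPQ hN h3 (hn.sub hn') heq).2 k hk le_rfl)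

/-- Strong induction on the index transfers the vanishing from a truncated solution to any full one.
-/
theorem focal_values_eq {P Q : MvPowerSeries (Fin 2) R} (hPQ : IsPerturbation P Q)
    (hN : ∀ n : ℕ, 1 ≤ n → IsUnit (n : R)) {k : ℕ} (hk : 1 ≤ k)
    {F F' : MvPowerSeries (Fin 2) R} {s s' : ℕ → R} (hF : StartsWithCircle F)
    (hF' : StartsWithCircle F')
    (h : VanishesBelow (2 * k + 3) (orbitalDeriv P Q F - focalSeries s))
    (h' : orbitalDeriv P Q F' = focalSeries s')
    (hs : ∀ j, 1 ≤ j → j < k → s j = 0) :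
    (∀ j, 1 ≤ j → j < k → s' j = 0) ∧ s' k = s k := by
  have h'' : ∀ n, VanishesBelow n (orbitalDeriv P Q F' - focalSeries s') := fun n => by
    rw [h', sub_self]
    exact fun _ _ => coeff_zero _
  have hz : ∀ j, 1 ≤ j → j < k → s' j = 0 := by
    intro j
    induction j using Nat.strong_induction_on with
    | _ j ih =>
      intro h1 h2
      rw [← hs j h1 h2]
      exact (focal_value_eq_of_previous_eq_zero hPQ h1 (fun n h _ => hN n h) hF hF'
        (h.mono (by omega)) (h'' _) (fun i hi hij => hs i hi (by omega))
        (fun i hi hij => ih i hij hi (by omega))).symm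
  exact ⟨hz, (focal_value_eq_of_previous_eq_zero hPQ hk (fun n h _ => hN n h) hF hF' h (h'' _)
    hs hz).symm⟩

end Canonical

/-! ### Transport along ring homomorphisms, and reduction of the theorem to one complex system. -/

theorem StartsWithCircle.map {R S : Type*} [CommRing R] [CommRing S] (φ : R →+* S)
    {F : MvPowerSeries (Fin 2) R} (hF : StartsWithCircle F) : StartsWithCircle (map φ F) := by
  intro d hd
  rw [coeff_map, hF d hd, ← coeff_map]
  simp

theorem isUnit_natCast_of_algebra_rat {R : Type*} [CommRing R] [Algebra ℚ R] (n : ℕ) (hn : 1 ≤ n) :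
    IsUnit (n : R) := by
  have : IsUnit (n : ℚ) := isUnit_iff_ne_zero.2 (by exact_mod_cast (by omega))
  simpa using this.map (algebraMap ℚ R)

theorem IsFocalSequence.map {R S : Type*} [CommRing R] [CommRing S] (φ : R →+* S) {d : ℕ}
    {c : CoeffIndex d → R} {s : ℕ → R} (h : IsFocalSequence (sysP c) (sysQ c) s) :
    IsFocalSequence (sysP (φ ∘ c)) (sysQ (φ ∘ c)) (φ ∘ s) := by
  obtain ⟨F, hF, h⟩ := h
  exact ⟨_, hF.map φ, by rw [← map_sysP, ← map_sysQ, ← map_orbitalDeriv, h, map_focalSeries]⟩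

/-- A system whose first non-vanishing focal value, among those computed from some `F`, is the
`k`-th one. -/
def HasFocalOrder {R : Type*} [CommRing R] {d : ℕ} (c : CoeffIndex d → R) (k : ℕ) : Prop :=
  ∃ F s, StartsWithCircle F ∧
    VanishesBelow (2 * k + 3) (orbitalDeriv (sysP c) (sysQ c) F - focalSeries s) ∧
    (∀ j, 1 ≤ j → j < k → s j = 0) ∧ s k ≠ 0

theorem HasFocalOrder.map {K L : Type*} [Field K] [Field L] (φ : K →+* L) {d : ℕ}
    {c : CoeffIndex d → K} {k : ℕ} (h : HasFocalOrder c k) : HasFocalOrder (φ ∘ c) k := by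
  obtain ⟨F, s, hF, h, hs, hk⟩ := h
  refine ⟨MvPowerSeries.map φ F, φ ∘ s, hF.map φ, ?_, fun j h1 h2 => by simp [hs j h1 h2],
    by simpa using hk⟩
  rw [← map_sysP, ← map_sysQ, ← map_orbitalDeriv, ← map_focalSeries, ← map_sub]
  exact h.map φ

theorem exists_isFocalPolynomials (d : ℕ) : ∃ s, IsFocalPolynomials d s :=
  exists_isFocalSequence (isPerturbation_sys _) fun n hn => isUnit_natCast_of_algebra_rat n hn

/-- Hilbert's basis theorem: the chain of focal ideals stabilizes. Without this, `sInf ∅ = 0` would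
make the lower bound for `centerBound` fail. -/
theorem centerBound_set_nonempty {d : ℕ} (s : ℕ → MvPolynomial (CoeffIndex d) ℚ) :
    {m : ℕ | ∀ c : CoeffIndex d → ℂ,
      (∀ j ∈ Set.Icc 1 m, MvPolynomial.aeval c (s j) = 0) →
        ∀ j, 1 ≤ j → MvPolynomial.aeval c (s j) = 0}.Nonempty := by
  have hmono : Monotone (focalIdeal s) := fun m n h =>
    Ideal.span_mono (Set.image_mono (Set.Icc_subset_Icc_right h))
  obtain ⟨m, hm⟩ := monotone_stabilizes_iff_noetherian.2
    (inferInstance : IsNoetherianRing (MvPolynomial (CoeffIndex d) ℚ)) ⟨focalIdeal s, hmono⟩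
  refine ⟨m, fun c hc j hj => ?_⟩
  have h1 : focalIdeal s m ≤ RingHom.ker (MvPolynomial.aeval (R := ℚ) c) := by
    refine Ideal.span_le.2 ?_
    rintro _ ⟨i, hi, rfl⟩
    exact hc i hi
  have h2 : s j ∈ focalIdeal s (max m j) :=
    Ideal.subset_span ⟨j, ⟨hj, le_max_right _ _⟩, rfl⟩
  have h3 : focalIdeal s m = focalIdeal s (max m j) := hm _ (le_max_left _ _)
  exact h1 (h3 ▸ h2)

/-- What a complex system with a focus of order exactly `k + 1` implies for the focal
polynomials. -/
theorem consequences_of_hasFocalOrder {d k : ℕ} {c : CoeffIndex d → ℂ}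
    (hc : HasFocalOrder c (k + 1)) {s : ℕ → MvPolynomial (CoeffIndex d) ℚ}
    (hs : IsFocalPolynomials d s) :
    s (k + 1) ∉ focalIdeal s k ∧ s (k + 1) ∉ (focalIdeal s k).radical ∧
    (∃ c : CoeffIndex d → ℂ,
      (∀ j ∈ Set.Icc 1 k, MvPolynomial.aeval c (s j) = 0) ∧
      MvPolynomial.aeval c (s (k + 1)) ≠ 0 ∧ ¬ HasFormalConstantOfMotion (sysP c) (sysQ c)) ∧
    k + 1 ≤ centerBound s := by
  obtain ⟨F, t, hF, h, ht, hk⟩ := hc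
  have hu : ∀ n : ℕ, 1 ≤ n → IsUnit (n : ℂ) := isUnit_natCast_of_algebra_rat
  have hmap := IsFocalSequence.map (MvPolynomial.aeval (R := ℚ) c).toRingHom hs
  have hcomp : (MvPolynomial.aeval (R := ℚ) c).toRingHom ∘ MvPolynomial.X = c := by
    ext i; simp
  rw [hcomp] at hmap
  obtain ⟨F', hF', h'⟩ := hmap
  obtain ⟨h1, h2⟩ := focal_values_eq (isPerturbation_sys c) hu (by omega) hF hF' h h' ht
  have hz : ∀ j ∈ Set.Icc 1 k, MvPolynomial.aeval c (s j) = 0 := fun j hj =>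
    h1 j hj.1 (Nat.lt_succ_of_le hj.2)
  have hne : MvPolynomial.aeval c (s (k + 1)) ≠ 0 := by
    have : MvPolynomial.aeval c (s (k + 1)) = t (k + 1) := h2
    rwa [this]
  have hrad : s (k + 1) ∉ (focalIdeal s k).radical := by
    have hle : focalIdeal s k ≤ RingHom.ker (MvPolynomial.aeval (R := ℚ) c) := by
      refine Ideal.span_le.2 ?_
      rintro _ ⟨i, hi, rfl⟩
      exact hz i hi
    have hprime := RingHom.ker_isPrime (MvPolynomial.aeval (R := ℚ) c)
    exact fun hmem => hne ((hprime.radical_le_iff.2 hle) hmem)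
  refine ⟨fun hmem => hrad (Ideal.le_radical hmem), hrad, ⟨c, hz, hne, ?_⟩, ?_⟩
  · rintro ⟨G, hG, hG0⟩
    refine hk ?_
    -- A formal constant of motion is a solution with all focal values 0, which would force t (k +
    -- 1) = 0.
    rw [← (focal_values_eq (s' := 0) (isPerturbation_sys c) hu (by omega) hF hG h
      (by rw [hG0]; ext d; simp [coeff_focalSeries]) ht).2]
    rfl
  · refine le_csInf (centerBound_set_nonempty s) fun m hm => ?_
    by_contra hlt
    exact hne (hm c (fun j hj => hz j ⟨hj.1, hj.2.trans (by omega)⟩) _ (by omega))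

/-! ### The computation modulo 29. -/

section Certificate

/-- The exponents of the nonlinear monomials of a cubic system. -/
def exponentList : List (ℕ × ℕ) := [(2, 0), (1, 1), (0, 2), (3, 0), (2, 1), (1, 2), (0, 3)]

theorem sum_exponents_three {M : Type*} [AddCommMonoid M] (f : ℕ × ℕ → M) :
    ∑ e : {e // e ∈ exponents 3}, f e.1 = (exponentList.map f).sum := by
  have h : exponents 3 = exponentList.toFinset := by decide
  rw [Finset.sum_coe_sort (exponents 3) f, h, List.sum_toFinset f (by decide)]

/-- Modulo `29`, the coefficient of `x ^ i * y ^ j` in `F_x y - F_y x`, where `F` has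
coefficients `f`. -/
def rotationCoeff (f : ℕ → ℕ → ℕ) (i j : ℕ) : ℕ :=
  (if 1 ≤ j then (i + 1) * f (i + 1) (j - 1) else 0) +
    28 * (if 1 ≤ i then (j + 1) * f (i - 1) (j + 1) else 0)

/-- Modulo `29`, the coefficient of `x ^ i * y ^ j` in `F_x q - F_y p`, where `F`, `p`, `q` have
coefficients `f`, `a`, `b`. -/
def nonlinearCoeff (a b : ℕ × ℕ → ℕ) (f : ℕ → ℕ → ℕ) (i j : ℕ) : ℕ :=
  (exponentList.map fun e => if e.1 ≤ i ∧ e.2 ≤ j then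
    b e * ((i - e.1 + 1) * f (i - e.1 + 1) (j - e.2)) +
      28 * (a e * ((j - e.2 + 1) * f (i - e.1) (j - e.2 + 1))) else 0).sum

variable {S : Type*} [CommRing S]

/-- The power series with natural number coefficients `f`. -/
def natSeries (S : Type*) [CommRing S] (f : ℕ → ℕ → ℕ) : MvPowerSeries (Fin 2) S :=
  fun d => (f (d 0) (d 1) : S)

theorem coeff_expo_natSeries (f : ℕ → ℕ → ℕ) (i j : ℕ) :
    coeff (expo i j) (natSeries S f) = (f i j : S) := by
  change (f (expo i j 0) (expo i j 1) : S) = _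
  rw [expo_zero, expo_one]

/-- The nonlinear part with natural number coefficients `a`. -/
noncomputable def natNonlinear (S : Type*) [CommRing S] (a : ℕ × ℕ → ℕ) :
    MvPowerSeries (Fin 2) S :=
  (exponentList.map fun e => C (a e : S) * (X 0 ^ e.1 * X 1 ^ e.2)).sum

/-- The certificate computes in ℕ, with 28 standing for -1; this is legitimate in any ring where 29
= 0. -/
theorem coeff_rotation_natSeries (h29 : (29 : S) = 0) (f : ℕ → ℕ → ℕ) (i j : ℕ) :
    coeff (expo i j) (rotation (natSeries S f)) = (rotationCoeff f i j : S) := by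
  have h28 : (28 : S) = -1 := by linear_combination h29
  rw [coeff_rotation, coeff_expo_natSeries, coeff_expo_natSeries, rotationCoeff]
  push_cast
  rw [h28]
  ring

theorem coeff_mul_natNonlinear (F : MvPowerSeries (Fin 2) S) (a : ℕ × ℕ → ℕ) (i j : ℕ) :
    coeff (expo i j) (F * natNonlinear S a) = (exponentList.map fun e =>
      if e.1 ≤ i ∧ e.2 ≤ j then (a e : S) * coeff (expo (i - e.1) (j - e.2)) F else 0).sum := by
  rw [natNonlinear, ← List.sum_map_mul_left, map_list_sum, List.map_map]
  congr 2
  ext e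
  simp only [Function.comp]
  rw [mul_left_comm, coeff_C_mul, coeff_mul_X_zero_pow_mul_X_one_pow, mul_ite, mul_zero]

theorem coeff_orbitalDeriv_natNonlinear (h29 : (29 : S) = 0) (a b : ℕ × ℕ → ℕ) (f : ℕ → ℕ → ℕ)
    (i j : ℕ) :
    coeff (expo i j) (orbitalDeriv (natNonlinear S a) (natNonlinear S b) (natSeries S f)) =
      (nonlinearCoeff a b f i j : S) := by
  have h28 : (28 : S) = -1 := by linear_combination h29
  rw [orbitalDeriv_eq, map_sub, coeff_mul_natNonlinear, coeff_mul_natNonlinear, nonlinearCoeff,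
    Nat.cast_list_sum, List.map_map, sub_eq_iff_eq_add, ← List.sum_map_add]
  congr 2
  ext e
  simp only [Function.comp, coeff_pderiv_zero, coeff_pderiv_one, coeff_expo_natSeries]
  split_ifs
  · push_cast
    rw [h28]
    ring
  · simp

/-- The coefficients of `P` and of its eleven variations, coded in base `32`. -/
def codeP : List ℕ :=
  [0x9001320344013c00,
   0xc00217018e007000,
   0x170009c071e0da400,
   0x70003705a20d1000,
   0xd000070716098800,
   0x13000b70662053400,
   0x100007900920ce000,
   0x30022f033003b000,
   0x19002b506ea051000,
   0x1500381013808ac00,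
   0x150032100e805bc00,
   0xf0006b01de020000]

/-- The coefficients of `Q` and of its eleven variations, coded in base `32`. -/
def codeQ : List ℕ :=
  [0x1b0034f0442073400,
   0xf03600c9000,
   0x190138034000,
   0x18009000f000,
   0xc009e033800,
   0x1101f80ad800,
   0x800a0055800,
   0xd052e075800,
   0x5019a019c00,
   0x3055203e800,
   0x301180d8c00,
   0x302de0c0000]

/-- The coefficients of `F` and of its eleven variations, coded in base `32`. -/
def codeF : List ℕ :=
  [0x97d82d4ed05c1cedab0c3796c5b080b900ba32a8a000c6702c38bf835dc2fc6c002c16d2424129e11b6a0a70da448370a031921e19c645808f672a013e6a61064185c02d066a765091612c350c18607533954b48135535265e5aec036e2a03aa80f35c90586c66c8ac09321c26f32a2f36a22a8c4811c36ab5a82194462acda67932fb0a07282dcc5a2a792c0d5e3bbdd1caad3c0e157bd096ca1a59c839b1c0805ea9ab9230c9911c82835708cc5ea3d217a0226457272cf16024b889db452458c801042185a18f313c61aae5c1a78059d82492fc188e8dea640100604635a1930a83221e5810a02008000,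
   0x11a9915a158a7e33b7f24b2816c73e4e92a36c9b2180f062638d245f4cc70b986c0b998c5bc67d81dcd9818bac8f1560e01e0bd8591c2af03b0e63d2f81ed0d06020088d18810335186745769d10d26caa94c4b95b6d3be47a44587027cc0e7a1d244322a6db126542b744f4fa6c53d4310ca291bac027e2574225a7b1b77e7374367483589d4cac491e426a006d1868e8726656ab4ab34296d614d66e8c585765020a2d513891153dbc484e466893668e875e007b370cc1ae86c5659cc77859729ddc12ac52a11185e48c5d41b54ed80722a0c867a91975a0f3104a2e5cd32811525814fd4da1dc80000000,
   0x5cb96952a77da79145d57bab803106495e2f8cf9bd3f4551b63d08549154019c409e081bc6528441c391a944d36e4627dc168dda12d86aec1e55d3ae55aadb03a7c7c848aa0017d307be52ed14fc2bea22706d03c193074605c78281a53f38661892570305b036b6761429f76b25c4384a3b67c97017400c848111a8ee15cc63a862bc42f08cb8eb4d7376b000b408306cd23f28e638805a263730250164ad78a01ee494126356149dde3230519a8e1b9cea602c39aa21bbcc7c22da468e851822a0416bc9f2924b7e5a179618263e0047214c874194829450a10319300d0542880d02696b9959140000000,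
   0xd840267c6437672152cd3871a61af9b3540edb8460256e0576a7eb44454e5cc3801c9e9e111888b55c991c14784397723eb88e1e87dd775ad367628255cb3c070f563a79e08b60bc761c036b06359549ba4c3163535ad8d8ca5d4481b82d05873036cedc9a58f33f0ecbd6099a0e04aaeda171a1e00c6ef2bc6ce598b748dde2a005b315148ed2fda31130ea0a95964dd5c7805a76c0ebbc01968186d1ba03ef3055db865196f2c7d126d51a0f938545b00a5038b8ce673950c6f3519a6868853ba000dc9e343d4d0034dce092dd67006d93b449197c7393ef0302a84d632acd453b801c8a7334500000000,
   0x11ae01776efb39f82c30525f2c8441ea5387a4a984904c4be06945c1270845a45a0b872535f004586dd81eb3c43b60eba34f23b1705ac1c32e9e6985381c76800c258b21b98930285752b86f4635ca98fa5c7566ec36cc332729ad280a3be302de876c61688ec67e48e8c0cec3d26c7ab8cd983441800cd72e8ccd44accd8f20155f01a5d26338b89856c1ed4049a8e286964be65a578808648a35d355220be7920620f5ec32c9a2720b595d7713d259e5cd3081697e5984be8c258dbe48f4cd28364c09493444835b798af758b52e1a0e05640d0aa43461759d2038b1aa5746ca3610249904f82480000000,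
   0x569238e6c5771e24ca392cd415b5b296ca049b620230984bb59dba4422928ce4a05db8f6a5b84b85caaab08db33b035a0ea651185c2e7796e0cd89f204337103f5426206065f9716680b1e89f07625d6ab8db1466dc5ddb873f68682882db485d472456287a899ca5249b4747166945e8cd300d63c0700f59701049b252cc56793893328e63c107c0936c4300da99763f8b7ee4584750cd4d1c8ce00d887cca270071ab576d4b6518dd0e1b638da0b5ad8831002b3d9c4e466d06d6c89298c6120060097098c20276b8d06b4db0d59202620e296579576e830f3029d2715a04b5daa83755b5c5d680000000,
   0x14896cba5c5891df5bd8a015d4b492f8b36e223cfa0eb8aa4f96561639ad5a3a340d186f5368279d1043db89c669521a88a4f922ac17e637a6e0ec3632ba87901995db21731a630506a8424c35ee52dc0b99f129d8c4a9eb62612fe0121aeab6e19b19e2e592efc729e131a53450404c5178ce09c100b4e931c8eec651aa82e54ad08f82f8e8f385cdc55d20e035042c4f4be0ed8acb78c18908ddb19bd0fae2ae055d6923779552ec3a8f39a22032d355d432827b328e9815d0cbe2740a86b1c6f3a41b8e5325cb7c5f0ed13c78b6a407c6ad0baab4000171f4a0070730443348f1700614b9309800000000,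
   0xb15f089f21cde1b5cc357d840fbbf4408017731991ef32e6b70cdc9662e60b6820a826a8e628356e3e1cb3b5729a06c2ae94a185ed9108c38d662eae22ce240480734f6a31c094d62899e0959c2a8aab0771e13d21a4a6c1a9da68837c7b5f2c45426c6ede0e820ee2b56202742c7c4030daeaa7140343032912a02813b9d18724041418c9e2cd818b236ac20a6928e461354124580b42d91010e6d05b381040d03b8576818d9cefa4f4ad2e4c4d7611e1e7a8364c160bce2d27152413f42c43229181bb4b849ce479dc80930d10bb0042066340e5b6dccc9b33049eca468c11e806803aa903ac400000000,
   0x180dd08dc09596514306aa15df780752a4db31447a030c80e1c81398f89a05312e0357153c5967810f3c513452b1e4b96ace0d901b4d527448e989de8863e3004a0d85ed6939ce00d6c3a889a4549e14919a6b59346578f2506e0d90395de632d0c0f068ee8ac997a99b60d708ea69be1c28a2d219002718634862c648597b49271548b55368192ec0f3a94f60348fb1920b0042ec81d3d43566dc3594a504a692065f336472959f58f0db9d173a54ad6d02a602c8b9559a95c3188231d9c6505a0a381b840f09ed9c85f87e4f092e200d8e01098785c5565730506930314c2c0f93483060902a41c0000000,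
   0xf7a66cb3928ae2a07a8cbe65b0e4e559890d4b13b0ed2e321cf11acb6ed4d8630092201b856c611fcc168f132f3528f1151c17179c58aa5451af0702f72d5c01270aa9402135238b73be4f1a61d65a0d96148094aeb885c065776480e1c6c673522f75af28d4a740b70ccd1b014ba43db36b81acc41a5197668859ae6ab46083c3a8c104e36bdd619c2d36460b982c7c5d6d983123a14e724b48589494cb1ae8602ca17236a2c5871ed7ace300350498de0aa00e3dc951c1d979118c70d66cc26de5006d0e27e689012c37deb990b5008bc34ad8af048f2d3cea062d4d051481496081a599266b580000000,
   0x12bdd4a2a8d59ee0cc11889476431567592659376aaddcfa453cae8499d9a693b60ab6f898544012f589cf49367518a826d4219214908d8583e66dd486c246e06ce303dd108e89ac38a585125c84c96d1a46186e456a74e15cb6d0b837ce3782d40122bd43bec3b5e05a7687439d1440f36e66a79cc1564dab3339268351b838594a2a436f15ce3a70d710cb80766f10e2f86836f744c61933282722dca559ac2903e797af755a72c4eec7be58ed2ee68e676582ade4a2db830d2f1425c7467f3861a0147a933d81a00e9f712930deb0019b0e29d59e4753a60a400df57dc49b18321824b3c4660b00000000,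
   0x16b4867aaf9b4bcab3df8bd3e966e0bc601e0551122266022ec2b4365089acbc6c0c4ae38e4e3dd346a6dd7c684b2c4ec6ea9b3bd55db92d784096f2201409a005dbcd14aae5586b6db088b244e8048b52246f021d370ddda645b87800f8d6139d07a34d556182f9c9ca6df26d88a300eacdc206b6016daccf780aec0014e1874ccdd73f295065b6101243c5606094518670142758b8a5556f2c802c8a23aded1603b5c95f5740a899984c0166b16f9754868c026f5b370e16449e73b75442024103d81724289d91d8b5e6c1598f6d22013d38a1f5a4964a61479066174bd8a04413801cfe38e605c0000000]

/-- The coefficient of `x ^ e.1 * y ^ e.2` in the coded nonlinear polynomial `n`. -/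
def decodeSystem (n : ℕ) (e : ℕ × ℕ) : ℕ := n / 32 ^ (4 * e.1 + e.2) % 32

/-- The coefficient of `x ^ i * y ^ j` in the coded series `n`. -/
def decodeSeries (n : ℕ) (i j : ℕ) : ℕ := n / 32 ^ ((i + j) * (i + j + 1) / 2 + i) % 32

/-- The residue of the focal equation at `x ^ i * y ^ j` for the `k`-th variation. -/
def focalResidue (a₀ b₀ f₀ a b f k i j : ℕ) : ℕ :=
  rotationCoeff (decodeSeries f) i j +
    nonlinearCoeff (decodeSystem a₀) (decodeSystem b₀) (decodeSeries f) i j +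
    if k = 0 then 0 else nonlinearCoeff (decodeSystem a) (decodeSystem b) (decodeSeries f₀) i j

/-- The focal value of index `n` of the `k`-th variation: the twelfth one of the system itself
is `1` and the `k`-th one of the `k`-th variation is `1`. -/
def expectedFocal (k n : ℕ) : ℕ := if n = (if k = 0 then 12 else k) then 1 else 0

/-- The focal equation of the `k`-th variation holds modulo `29` up to degree `26`. -/
def checkFocal (a₀ b₀ f₀ a b f k : ℕ) : Bool :=
  (List.range 27).all fun d => (List.range (d + 1)).all fun i =>
    focalResidue a₀ b₀ f₀ a b f k i (d - i) % 29 ==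
      if (i = 0 ∨ d - i = 0) ∧ d % 2 = 0 ∧ 4 ≤ d then expectedFocal k (d / 2 - 1) else 0

/-- Base-32 digits hold residues modulo 29; systems are stored at position 4i + j, series by degree
and then by i. Degree 26 = 2 · 12 + 2 is where the twelfth focal value sits. For k ≥ 1 the identity
checked is the focal equation linearized in direction k. -/
theorem checkFocal_eq_true : (List.range 12).all (fun k =>
    checkFocal (codeP.getD 0 0) (codeQ.getD 0 0) (codeF.getD 0 0) (codeP.getD k 0)
      (codeQ.getD k 0) (codeF.getD k 0) k) = true := by
  decide +kernel

/-- The coded series are normalized and start correctly. -/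
theorem checkStart_eq_true : ((List.range 12).all fun k =>
    ((List.range 3).all fun d => (List.range (d + 1)).all fun i =>
      decodeSeries (codeF.getD k 0) i (d - i) ==
        if k = 0 ∧ ((i = 2 ∧ d - i = 0) ∨ (i = 0 ∧ d - i = 2)) then 1 else 0) &&
    ((List.range 27).all fun n => n < 3 || n % 2 == 1 ||
      decodeSeries (codeF.getD k 0) n 0 == 0)) = true := by
  decide +kernel

end Certificate

/-! ### First-order deformations of the coded system. -/

section Variation

variable {S : Type*} [CommRing S]

/-- The orbital derivative is bilinear in (P, Q) and F, and the second-order terms die because all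
products of the ε vanish. -/
theorem orbitalDeriv_variation {ι : Type*} [Fintype ι] {ε : ι → S} (hε : ∀ a b, ε a * ε b = 0)
    (P₀ Q₀ F₀ : MvPowerSeries (Fin 2) S) (P Q F : ι → MvPowerSeries (Fin 2) S) :
    orbitalDeriv (P₀ + ∑ k, C (ε k) * P k) (Q₀ + ∑ k, C (ε k) * Q k) (F₀ + ∑ k, C (ε k) * F k) =
      orbitalDeriv P₀ Q₀ F₀ +
        ∑ k, C (ε k) * (orbitalDeriv P₀ Q₀ (F k) + orbitalDeriv (P k) (Q k) F₀) := by
  have hprod : ∀ A B : ι → MvPowerSeries (Fin 2) S,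
      (∑ k, C (ε k) * A k) * ∑ k, C (ε k) * B k = 0 := by
    intro A B
    rw [Finset.sum_mul_sum]
    refine Finset.sum_eq_zero fun k _ => Finset.sum_eq_zero fun l _ => ?_
    rw [mul_mul_mul_comm, ← map_mul, hε, map_zero, zero_mul]
  have hd : ∀ i, pderiv S i (F₀ + ∑ k, C (ε k) * F k) =
      pderiv S i F₀ + ∑ k, C (ε k) * pderiv S i (F k) := by
    intro i
    rw [map_add, map_sum]
    congr 1
    refine Finset.sum_congr rfl fun k _ => ?_
    rw [Derivation.leibniz, pderiv_C, smul_zero, add_zero, smul_eq_mul]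
  have hsum : ∑ k, C (ε k) * (orbitalDeriv P₀ Q₀ (F k) + orbitalDeriv (P k) (Q k) F₀) =
      (∑ k, C (ε k) * pderiv S 0 (F k)) * Q₀ - (∑ k, C (ε k) * pderiv S 1 (F k)) * P₀ +
        (pderiv S 0 F₀ * (∑ k, C (ε k) * Q k) - pderiv S 1 F₀ * ∑ k, C (ε k) * P k) := by
    simp only [Finset.sum_mul, Finset.mul_sum, ← Finset.sum_sub_distrib, ← Finset.sum_add_distrib,
      orbitalDeriv_eq]
    exact Finset.sum_congr rfl fun k _ => by ring
  rw [hsum, orbitalDeriv_eq, orbitalDeriv_eq, hd, hd]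
  linear_combination hprod (fun k => pderiv S 0 (F k)) Q - hprod (fun k => pderiv S 1 (F k)) P

/-- The cubic system coded above, displaced by `ε` along its eleven variations. -/
def variedSystem (ε : Fin 11 → S) : CoeffIndex 3 → S :=
  Sum.elim
    (fun e => (decodeSystem (codeP.getD 0 0) e.1 : S) +
      ∑ k : Fin 11, ε k * (decodeSystem (codeP.getD (k + 1) 0) e.1 : S))
    (fun e => (decodeSystem (codeQ.getD 0 0) e.1 : S) +
      ∑ k : Fin 11, ε k * (decodeSystem (codeQ.getD (k + 1) 0) e.1 : S))

theorem comp_variedSystem {T : Type*} [CommRing T] (φ : S →+* T) (ε : Fin 11 → S) :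
    φ ∘ variedSystem ε = variedSystem (φ ∘ ε) := by
  ext i
  rcases i with e | e <;> simp [variedSystem]

theorem sum_exponents_variation (ε : Fin 11 → S) (a₀ : ℕ × ℕ → ℕ) (a : Fin 11 → ℕ × ℕ → ℕ) :
    ∑ e : {e // e ∈ exponents 3}, C ((a₀ e.1 : S) + ∑ k, ε k * (a k e.1 : S)) *
        (X 0 ^ e.1.1 * X 1 ^ e.1.2) =
      natNonlinear S a₀ + ∑ k, C (ε k) * natNonlinear S (a k) := by
  simp only [natNonlinear, ← sum_exponents_three, map_add, map_sum, map_mul, add_mul,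
    Finset.sum_mul, Finset.sum_add_distrib, Finset.mul_sum]
  rw [Finset.sum_comm]
  simp only [mul_assoc]

theorem sysP_variedSystem (ε : Fin 11 → S) :
    sysP (variedSystem ε) = X 0 + natNonlinear S (decodeSystem (codeP.getD 0 0)) +
      ∑ k : Fin 11, C (ε k) * natNonlinear S (decodeSystem (codeP.getD (k + 1) 0)) := by
  rw [add_assoc, ← sum_exponents_variation ε _ fun k : Fin 11 =>
    decodeSystem (codeP.getD (k + 1) 0)]
  rfl

theorem sysQ_variedSystem (ε : Fin 11 → S) :
    sysQ (variedSystem ε) = X 1 + natNonlinear S (decodeSystem (codeQ.getD 0 0)) +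
      ∑ k : Fin 11, C (ε k) * natNonlinear S (decodeSystem (codeQ.getD (k + 1) 0)) := by
  rw [add_assoc, ← sum_exponents_variation ε _ fun k : Fin 11 =>
    decodeSystem (codeQ.getD (k + 1) 0)]
  rfl

/-- The series coded above for the system `variedSystem ε`. -/
noncomputable def variedSeries (ε : Fin 11 → S) : MvPowerSeries (Fin 2) S :=
  natSeries S (decodeSeries (codeF.getD 0 0)) +
    ∑ k : Fin 11, C (ε k) * natSeries S (decodeSeries (codeF.getD (k + 1) 0))

theorem coeff_expo_variedSeries (ε : Fin 11 → S) (i j : ℕ) :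
    coeff (expo i j) (variedSeries ε) = (decodeSeries (codeF.getD 0 0) i j : S) +
      ∑ k : Fin 11, ε k * (decodeSeries (codeF.getD (k + 1) 0) i j : S) := by
  simp only [variedSeries, map_add, map_sum, coeff_C_mul, coeff_expo_natSeries]

theorem decodeSeries_start {k : ℕ} (hk : k < 12) {i j : ℕ} (hij : i + j < 3) :
    decodeSeries (codeF.getD k 0) i j =
      if k = 0 ∧ ((i = 2 ∧ j = 0) ∨ (i = 0 ∧ j = 2)) then 1 else 0 := by
  have h := checkStart_eq_true
  simp only [List.all_eq_true, List.mem_range, Bool.and_eq_true, beq_iff_eq] at h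
  have := (h k hk).1 (i + j) hij i (by omega)
  rwa [Nat.add_sub_cancel_left] at this

theorem decodeSeries_normalized {k : ℕ} (hk : k < 12) {n : ℕ} (h3 : 3 ≤ n) (hn : n < 27)
    (he : Even n) : decodeSeries (codeF.getD k 0) n 0 = 0 := by
  have h := checkStart_eq_true
  simp only [List.all_eq_true, List.mem_range, Bool.and_eq_true, Bool.or_eq_true, beq_iff_eq,
    decide_eq_true_eq] at h
  rw [Nat.even_iff] at he
  rcases (h k hk).2 n hn with (h' | h') | h'
  · omega
  · omega
  · exact h'

theorem startsWithCircle_variedSeries (ε : Fin 11 → S) : StartsWithCircle (variedSeries ε) := by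
  rw [startsWithCircle_iff, vanishesBelow_iff_expo]
  intro i j hij
  rw [map_sub, coeff_expo_variedSeries, coeff_expo_circle, decodeSeries_start (by omega) hij,
    Finset.sum_eq_zero fun k _ => ?_]
  · simp
  · rw [decodeSeries_start (by omega) hij, if_neg (by simp), Nat.cast_zero, mul_zero]

theorem isNormalized_variedSeries (ε : Fin 11 → S) : IsNormalized (variedSeries ε) 26 := by
  intro n h3 hn he
  rw [coeff_expo_variedSeries, decodeSeries_normalized (by omega) h3 (by omega) he,
    Finset.sum_eq_zero fun k _ => ?_]
  · simp
  · rw [decodeSeries_normalized (by omega) h3 (by omega) he, Nat.cast_zero, mul_zero]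

theorem cast_focalResidue (h29 : (29 : S) = 0) {k : ℕ} (hk : k < 12) {i j : ℕ}
    (hij : i + j < 27) :
    (focalResidue (codeP.getD 0 0) (codeQ.getD 0 0) (codeF.getD 0 0) (codeP.getD k 0)
      (codeQ.getD k 0) (codeF.getD k 0) k i j : S) =
      coeff (expo i j) (focalSeries fun n => (expectedFocal k n : S)) := by
  have h := checkFocal_eq_true
  simp only [checkFocal, List.all_eq_true, List.mem_range, beq_iff_eq] at h
  have := h k hk (i + j) hij i (by omega)
  rw [Nat.add_sub_cancel_left] at this
  rw [coeff_expo_focalSeries, ← Nat.div_add_mod (focalResidue _ _ _ _ _ _ _ _ _) 29, this]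
  push_cast
  rw [h29, zero_mul, zero_add]
  simp only [Nat.even_iff]

theorem vanishesBelow_variedSeries (h29 : (29 : S) = 0) {ε : Fin 11 → S}
    (hε : ∀ a b, ε a * ε b = 0) :
    VanishesBelow 27 (orbitalDeriv (sysP (variedSystem ε)) (sysQ (variedSystem ε))
      (variedSeries ε) - focalSeries fun n => (expectedFocal 0 n : S) +
        ∑ k : Fin 11, ε k * (expectedFocal (k + 1) n : S)) := by
  have hlin : ∀ p q F : MvPowerSeries (Fin 2) S,
      orbitalDeriv (X 0 + p) (X 1 + q) F = rotation F + orbitalDeriv p q F := by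
    intro p q F
    simp only [rotation, orbitalDeriv_eq]; ring
  rw [sysP_variedSystem, sysQ_variedSystem, variedSeries, orbitalDeriv_variation hε,
    vanishesBelow_iff_expo]
  intro i j hij
  simp only [map_sub, map_add, map_sum, coeff_C_mul, hlin, coeff_rotation_natSeries h29,
    coeff_orbitalDeriv_natNonlinear h29]
  have h0 := cast_focalResidue h29 (k := 0) (by omega) hij
  simp only [focalResidue, if_true, Nat.add_zero] at h0
  have hs : ∀ k : Fin 11, _ := fun k => cast_focalResidue h29 (k := k + 1) (by omega) hij
  simp only [focalResidue, Nat.succ_ne_zero, if_false, Nat.cast_add] at h0 hs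
  rw [h0]
  simp only [hs, coeff_expo_focalSeries]
  split_ifs <;> simp

/-- The normalized focal values of `variedSystem ε`, for infinitesimal `ε` in characteristic
`29`. -/
theorem focal_values_variedSystem (h29 : (29 : S) = 0) {ε : Fin 11 → S}
    (hε : ∀ a b, ε a * ε b = 0) {F : MvPowerSeries (Fin 2) S} {s : ℕ → S}
    (hF : StartsWithCircle F) (hn : IsNormalized F 26)
    (h : VanishesBelow 27 (orbitalDeriv (sysP (variedSystem ε)) (sysQ (variedSystem ε)) F -
      focalSeries s)) :
    (∀ k : Fin 11, s (k + 1) = ε k) ∧ s 12 = 1 := by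
  -- Such n is coprime to 29, and a Bézout relation inverts it because 29 = 0 in S.
  have hN : ∀ n : ℕ, 1 ≤ n → n ≤ 26 → IsUnit (n : S) := by
    intro n h1 h2
    have hc : IsCoprime (n : ℤ) (29 : ℕ) :=
      Nat.isCoprime_iff_coprime.2 ((Nat.coprime_comm.1
        ((Nat.Prime.coprime_iff_not_dvd (by norm_num)).2 fun hd =>
          absurd (Nat.le_of_dvd (by omega) hd) (by omega))))
    obtain ⟨a, b, hab⟩ := hc
    have := congrArg (Int.cast : ℤ → S) hab
    push_cast at this
    rw [h29, mul_zero, add_zero] at this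
    exact IsUnit.of_mul_eq_one_right _ this
  have h3 : VanishesBelow 3 (F - variedSeries ε) := by
    have := (startsWithCircle_iff.1 hF).sub
      (startsWithCircle_iff.1 (startsWithCircle_variedSeries ε))
    rwa [sub_sub_sub_cancel_right] at this
  have hd := h.sub (vanishesBelow_variedSeries h29 hε)
  rw [sub_sub_sub_comm, ← orbitalDeriv_sub, focalSeries_sub] at hd
  -- The coded series is also a normalized solution, so uniqueness applied to the difference
  -- identifies the focal values.
  have key := (focal_unique (isPerturbation_sys _) hN h3 (hn.sub (isNormalized_variedSeries ε))
    hd).2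
  refine ⟨fun k => ?_, ?_⟩
  · rw [sub_eq_zero.1 (key (k + 1) (by omega) (by omega)), Finset.sum_eq_single k]
    · simp [expectedFocal]
      omega
    · intro l _ hl
      have : ¬ (k : ℕ) + 1 = l + 1 := fun h => hl (Fin.ext (by omega))
      simp [expectedFocal, Fin.val_inj, hl.symm]
    · simp
  · rw [sub_eq_zero.1 (key 12 (by omega) (by omega)), Finset.sum_eq_zero fun k _ => ?_]
    · simp [expectedFocal]
    · have : ¬ (12 = (k : ℕ) + 1) := by omega
      simp [expectedFocal, this]

end Variation

end FocalValues

namespace FocalValues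

/-! ### A multivariate Hensel lemma over the p-adic integers. -/

section Hensel

open MvPolynomial

variable {p : ℕ} [Fact p.Prime] {ι : Type*} [Fintype ι]

/-- The ideal generated by `p` and the products of two variables. -/
noncomputable def infinitesimalIdeal (p : ℕ) [Fact p.Prime] (ι : Type*) :
    Ideal (MvPolynomial ι ℤ_[p]) :=
  Ideal.span (insert (p : MvPolynomial ι ℤ_[p]) (Set.range fun a : ι × ι => X a.1 * X a.2))

/-- Polynomials with p-adic integer coefficients are 1-Lipschitz for the sup norm, by the
ultrametric inequality. -/
theorem norm_eval_sub_eval_le (u : MvPolynomial ι ℤ_[p]) (h h' : ι → ℤ_[p]) :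
    ‖eval h u - eval h' u‖ ≤ ‖h - h'‖ := by
  induction u using MvPolynomial.induction_on with
  | C a => simp
  | add u v hu hv =>
    rw [map_add, map_add, add_sub_add_comm]
    exact (PadicInt.nonarchimedean _ _).trans (max_le hu hv)
  | mul_X u i hu =>
    have e : eval h (u * X i) - eval h' (u * X i) =
        (eval h u - eval h' u) * h i + eval h' u * (h i - h' i) := by
      simp only [map_mul, eval_X]; ring
    rw [e]
    refine (PadicInt.nonarchimedean _ _).trans (max_le ?_ ?_)
    · rw [norm_mul]
      exact (mul_le_of_le_one_right (norm_nonneg _) (PadicInt.norm_le_one _)).trans hu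
    · rw [norm_mul]
      exact (mul_le_of_le_one_left (norm_nonneg _) (PadicInt.norm_le_one _)).trans
        (norm_le_pi_norm (h - h') i)

/-- On the ball of radius 1/p, p and the products of two variables are both small and
(1/p)-Lipschitz. The two bounds are proved together: the Lipschitz bound for a multiple a · u uses
the size of u. -/
theorem norm_eval_le_of_mem_infinitesimalIdeal {u : MvPolynomial ι ℤ_[p]}
    (hu : u ∈ infinitesimalIdeal p ι) {h h' : ι → ℤ_[p]} (hh : ‖h‖ ≤ (p : ℝ)⁻¹)
    (hh' : ‖h'‖ ≤ (p : ℝ)⁻¹) :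
    ‖eval h u‖ ≤ (p : ℝ)⁻¹ ∧ ‖eval h u - eval h' u‖ ≤ (p : ℝ)⁻¹ * ‖h - h'‖ := by
  have hp : (0 : ℝ) ≤ (p : ℝ)⁻¹ := by positivity
  refine Submodule.span_induction (p := fun u _ => ‖eval h u‖ ≤ (p : ℝ)⁻¹ ∧
    ‖eval h u - eval h' u‖ ≤ (p : ℝ)⁻¹ * ‖h - h'‖) ?_ ?_ ?_ ?_ hu
  · rintro u (rfl | ⟨⟨a, b⟩, rfl⟩)
    · simp only [map_natCast, sub_self, norm_zero, PadicInt.norm_p, le_refl, true_and]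
      positivity
    · have h1 : ∀ i, ‖h i‖ ≤ (p : ℝ)⁻¹ := fun i => (norm_le_pi_norm h i).trans hh
      have h1' : ∀ i, ‖h' i‖ ≤ (p : ℝ)⁻¹ := fun i => (norm_le_pi_norm h' i).trans hh'
      have hd : ∀ i, ‖h i - h' i‖ ≤ ‖h - h'‖ := fun i => norm_le_pi_norm (h - h') i
      simp only [map_mul, eval_X]
      refine ⟨?_, ?_⟩
      · rw [norm_mul]
        exact (mul_le_of_le_one_right (norm_nonneg _) (PadicInt.norm_le_one _)).trans (h1 a)
      · rw [show h a * h b - h' a * h' b = h a * (h b - h' b) + h' b * (h a - h' a) by ring]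
        refine (PadicInt.nonarchimedean _ _).trans (max_le ?_ ?_)
        · rw [norm_mul]
          exact mul_le_mul (h1 a) (hd b) (norm_nonneg _) hp
        · rw [norm_mul]
          exact mul_le_mul (h1' b) (hd a) (norm_nonneg _) hp
  · simp only [map_zero, sub_self, norm_zero]
    exact ⟨hp, by positivity⟩
  · rintro u v - - ⟨hu, hu'⟩ ⟨hv, hv'⟩
    simp only [map_add, add_sub_add_comm]
    exact ⟨(PadicInt.nonarchimedean _ _).trans (max_le hu hv),
      (PadicInt.nonarchimedean _ _).trans (max_le hu' hv')⟩
  · rintro a u - ⟨hu, hu'⟩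
    simp only [smul_eq_mul, map_mul]
    refine ⟨?_, ?_⟩
    · rw [norm_mul]
      exact (mul_le_of_le_one_left (norm_nonneg _) (PadicInt.norm_le_one _)).trans hu
    · rw [show eval h a * eval h u - eval h' a * eval h' u =
        eval h' a * (eval h u - eval h' u) + eval h u * (eval h a - eval h' a) by ring]
      refine (PadicInt.nonarchimedean _ _).trans (max_le ?_ ?_)
      · rw [norm_mul]
        exact (mul_le_of_le_one_left (norm_nonneg _) (PadicInt.norm_le_one _)).trans hu'
      · rw [norm_mul]
        exact mul_le_mul hu (norm_eval_sub_eval_le a h h') (norm_nonneg _) hp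

/-- A square system of `p`-adic polynomial equations that is the identity to first order has a
root in the open unit polydisc. -/
theorem exists_common_root {f : ι → MvPolynomial ι ℤ_[p]}
    (hf : ∀ k, f k - X k ∈ infinitesimalIdeal p ι) :
    ∃ h : ι → ℤ_[p], ‖h‖ ≤ (p : ℝ)⁻¹ ∧ ∀ k, eval h (f k) = 0 := by
  have hp0 : (0 : ℝ) ≤ (p : ℝ)⁻¹ := by positivity
  have hp1 : (p : ℝ)⁻¹ < 1 := inv_lt_one_of_one_lt₀ (by exact_mod_cast (Fact.out : p.Prime).one_lt)
  -- This is h ↦ h - f(h), whose fixed points are the common roots; it contracts the ball by the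
  -- factor 1/p.
  let g : (ι → ℤ_[p]) → ι → ℤ_[p] := fun h k => - eval h (f k - X k)
  have hmaps : Set.MapsTo g (Metric.closedBall 0 (p : ℝ)⁻¹) (Metric.closedBall 0 (p : ℝ)⁻¹) := by
    intro h hh
    rw [mem_closedBall_zero_iff] at hh ⊢
    rw [pi_norm_le_iff_of_nonneg hp0]
    intro k
    rw [norm_neg]
    exact (norm_eval_le_of_mem_infinitesimalIdeal (hf k) hh hh).1
  have hcontr : ContractingWith ((p : NNReal)⁻¹) (hmaps.restrict g _ _) := by
    refine ⟨by exact_mod_cast hp1, LipschitzWith.of_dist_le_mul ?_⟩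
    rintro ⟨h, hh⟩ ⟨h', hh'⟩
    rw [mem_closedBall_zero_iff] at hh hh'
    rw [Subtype.dist_eq, Subtype.dist_eq, dist_eq_norm, dist_eq_norm]
    change ‖g h - g h'‖ ≤ _ * ‖h - h'‖
    rw [pi_norm_le_iff_of_nonneg (by positivity)]
    intro k
    change ‖- eval h (f k - X k) - - eval h' (f k - X k)‖ ≤ _
    rw [neg_sub_neg, norm_sub_rev]
    simpa using (norm_eval_le_of_mem_infinitesimalIdeal (hf k) hh hh').2
  obtain ⟨h, hh, hfix, -⟩ := hcontr.exists_fixedPoint' (x := 0)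
    Metric.isClosed_closedBall.isComplete hmaps (Metric.mem_closedBall_self hp0)
    (edist_ne_top _ _)
  refine ⟨h, by simpa using hh, fun k => ?_⟩
  have : - eval h (f k - X k) = h k := congrFun hfix k
  rw [map_sub, eval_X] at this
  linear_combination -this

end Hensel

/-! ### An abstract field embedding of ℚ_p in ℂ. -/

section Transfer

open Cardinal

theorem mk_padic_le_continuum (p : ℕ) [Fact p.Prime] : #ℚ_[p] ≤ 𝔠 :=
  calc #ℚ_[p] ≤ #(CauSeq ℚ (padicNorm p)) := Cardinal.mk_quotient_le
    _ ≤ #(ℕ → ℚ) := Cardinal.mk_subtype_le _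
    _ = 𝔠 := by simp

/-- Steinitz: algebraically closed fields of characteristic 0 and the same uncountable cardinality
are isomorphic. The algebraic closure of ℚ_p has the cardinality of the continuum, like ℂ. -/
theorem nonempty_padic_ringHom_complex (p : ℕ) [Fact p.Prime] : Nonempty (ℚ_[p] →+* ℂ) := by
  have h1 : 𝔠 ≤ #ℚ_[p] := continuum_le_cardinal_of_nontriviallyNormedField ℚ_[p]
  have h2 : #(AlgebraicClosure ℚ_[p]) = 𝔠 := by
    refine le_antisymm ?_ ?_
    · refine (Algebra.IsAlgebraic.cardinalMk_le_max ℚ_[p] (AlgebraicClosure ℚ_[p])).trans ?_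
      exact max_le (mk_padic_le_continuum p) aleph0_le_continuum
    · exact h1.trans (Cardinal.mk_le_of_injective
        (algebraMap ℚ_[p] (AlgebraicClosure ℚ_[p])).injective)
  have : CharZero (AlgebraicClosure ℚ_[p]) :=
    charZero_of_injective_algebraMap (algebraMap ℚ_[p] _).injective
  obtain ⟨e⟩ := IsAlgClosed.ringEquiv_of_equiv_of_charZero (K := AlgebraicClosure ℚ_[p]) (L := ℂ)
    (by rw [h2]; exact aleph0_lt_continuum)
    (Cardinal.eq.1 (h2.trans Cardinal.mk_complex.symm))
  exact ⟨e.toRingHom.comp (algebraMap _ _)⟩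

end Transfer

/-! ### Lifting the certificate to a 29-adic system. -/

section Existence

open MvPowerSeries

instance fact_prime_twentyNine : Fact (Nat.Prime 29) := ⟨by norm_num⟩

theorem isUnit_natCast_of_lt_twentyNine {S : Type*} [CommRing S] [Algebra ℤ_[29] S] (n : ℕ)
    (h1 : 1 ≤ n) (h2 : n < 29) : IsUnit (n : S) := by
  have h : IsUnit (n : ℤ_[29]) := by
    rw [PadicInt.isUnit_iff, PadicInt.norm_natCast_eq_one_iff,
      fact_prime_twentyNine.out.coprime_iff_not_dvd]
    exact fun hd => absurd (Nat.le_of_dvd h1 hd) (by omega)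
  simpa using h.map (algebraMap ℤ_[29] S)

/-- There is a cubic system over the `29`-adic numbers whose first eleven focal values vanish,
while the twelfth does not. -/
theorem exists_hasFocalOrder_padic : ∃ c : CoeffIndex 3 → ℚ_[29], HasFocalOrder c 12 := by
  -- The eleven displacements are kept as variables. Up to degree 26 only integers below 29 are
  -- inverted, so the focal values are polynomials over ℤ_29.
  obtain ⟨F, s, hF⟩ := exists_isFocalUpTo
    (isPerturbation_sys (variedSystem (MvPolynomial.X : Fin 11 → MvPolynomial (Fin 11) ℤ_[29]))) 26
    (fun n h1 h2 => isUnit_natCast_of_lt_twentyNine n h1 (by omega))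
  let I := infinitesimalIdeal 29 (Fin 11)
  have h29 : (29 : MvPolynomial (Fin 11) ℤ_[29] ⧸ I) = 0 := by
    have : Ideal.Quotient.mk I ((29 : ℕ) : MvPolynomial (Fin 11) ℤ_[29]) = 0 :=
      Ideal.Quotient.eq_zero_iff_mem.2 (Ideal.subset_span (Set.mem_insert _ _))
    rw [map_natCast] at this
    exact_mod_cast this
  have hε : ∀ a b : Fin 11, (Ideal.Quotient.mk I ∘ MvPolynomial.X) a *
      (Ideal.Quotient.mk I ∘ MvPolynomial.X) b = 0 := fun a b => by
    rw [Function.comp, Function.comp, ← map_mul]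
    exact Ideal.Quotient.eq_zero_iff_mem.2
      (Ideal.subset_span (Set.mem_insert_of_mem _ ⟨(a, b), rfl⟩))
  have heqn := hF.eqn.map (Ideal.Quotient.mk I)
  rw [map_sub, map_orbitalDeriv, map_focalSeries, map_sysP, map_sysQ, comp_variedSystem] at heqn
  obtain ⟨hs, hs12⟩ := focal_values_variedSystem h29 hε (hF.start.map _)
    ((hF.normalized 26).map _) heqn
  -- Modulo 29 and products of variables, s_(k+1) is the variable of index k, which is the
  -- hypothesis of the Hensel lemma.
  obtain ⟨h, hh, hroot⟩ := exists_common_root (p := 29) (f := fun k : Fin 11 => s (k + 1))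
    fun k => Ideal.Quotient.eq.1 (hs k)
  have hlt : ((29 : ℕ) : ℝ)⁻¹ < 1 := by norm_num
  have h12 : MvPolynomial.eval h (s 12) ≠ 0 := by
    intro h0
    -- s_12 - 1 lies in the ideal, so s_12 is congruent to 1 modulo 29 at the root.
    have hmem : s 12 - 1 ∈ I := Ideal.Quotient.eq.1 (by rw [map_one]; exact hs12)
    have := (norm_eval_le_of_mem_infinitesimalIdeal hmem hh hh).1
    rw [map_sub, h0, map_one, zero_sub, norm_neg, norm_one] at this
    linarith
  let φ : MvPolynomial (Fin 11) ℤ_[29] →+* ℚ_[29] :=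
    (algebraMap ℤ_[29] ℚ_[29]).comp (MvPolynomial.eval h)
  refine ⟨φ ∘ variedSystem MvPolynomial.X, map φ F, φ ∘ s, hF.start.map φ, ?_, ?_, ?_⟩
  · rw [← map_sysP, ← map_sysQ, ← map_orbitalDeriv, ← map_focalSeries, ← map_sub]
    exact hF.eqn.map φ
  · intro j h1 h2
    have := hroot ⟨j - 1, by omega⟩
    simp only [Nat.sub_add_cancel h1] at this
    change algebraMap ℤ_[29] ℚ_[29] (MvPolynomial.eval h (s j)) = 0
    rw [this, map_zero]
  · change algebraMap ℤ_[29] ℚ_[29] (MvPolynomial.eval h (s 12)) ≠ 0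
    exact (map_ne_zero_iff _ (IsFractionRing.injective ℤ_[29] ℚ_[29])).2 h12

end Existence

end FocalValues

/-! ### The main theorem. -/

theorem mainTheorem1 :
    (∃ s : ℕ → MvPolynomial (FocalValues.CoeffIndex 3) ℚ,
      FocalValues.IsFocalPolynomials 3 s) ∧
    ∀ s : ℕ → MvPolynomial (FocalValues.CoeffIndex 3) ℚ,
      FocalValues.IsFocalPolynomials 3 s →
        s 12 ∉ FocalValues.focalIdeal s 11 ∧
        s 12 ∉ (FocalValues.focalIdeal s 11).radical ∧
        (∃ c : FocalValues.CoeffIndex 3 → ℂ,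
          (∀ j ∈ Set.Icc 1 11, MvPolynomial.aeval c (s j) = 0) ∧
          MvPolynomial.aeval c (s 12) ≠ 0 ∧
          ¬ FocalValues.HasFormalConstantOfMotion
            (FocalValues.sysP c) (FocalValues.sysQ c)) ∧
        12 ≤ FocalValues.centerBound s := by
  refine ⟨FocalValues.exists_isFocalPolynomials 3, fun s hs => ?_⟩
  obtain ⟨c, hc⟩ := FocalValues.exists_hasFocalOrder_padic
  obtain ⟨φ⟩ := FocalValues.nonempty_padic_ringHom_complex 29
  exact FocalValues.consequences_of_hasFocalOrder (hc.map φ) hs
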